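/- Let $\mathbb{N}=\{0,1,2,\dots\}$. The James space $J$ is the space of all real sequences $x=(x(n))_{n\in\mathbb{N}}$ with $$\|x\|_J=\sup\Bigl\{\Bigl(\sum_{i=1}^{n}\bigl|\sum_{k\in I_i}x(k)\bigr|^2\Bigr)^{1/2}: n\in\mathbb{N},\ I_1,\dots,I_n\text{ pairwise disjoint finite intervals of }\mathbb{N}\Bigr\}<\infty .$$ Let $(J^*,\|\cdot\|_*)$ be its dual. For a non-empty (finite or infinite) interval $I$ of $\mathbb{N}$ let $I^*\in J^*$ be the functional $I^*(x)=\sum_{n\in I}x(n)$, and let $e_n^*=\{n\}^*$, so that $e_n^*(x)=x(n)$. Let $\mathrm{Ext}(B_{J^*})$ be the set of extreme points of the closed unit ball of $J^*$ and $S_{J^*}$ its unit sphere. Let $\mathcal{D}\subset J^*$ be the set of all $\sum_{i=1}^k a_iI_i^*$ with $k\in\mathbb{N}$, pairwise disjoint non-empty finite intervals $I_1,\dots,I_k$ of $\mathbb{N}$ and $\bigl(\sum_{i=1}^k a_i^2\bigr)^{1/2}\le 1$, and let $\mathcal{D}_1$ be its $w^*$-closure in $J^*$. 1. $\mathrm{Ext}(B_{J^*})$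 is not norm-closed. Explicitly, let $$x^*=\tfrac{1}{\sqrt2}(e_0^*-e_3^*),\qquad x_m^*=\tfrac{m}{\sqrt{2(m^2+1)}}\bigl(e_0^*-\tfrac1m e_1^*+\tfrac1m e_2^*-e_3^*\bigr)\quad(m\ge 1).$$ Then $x^*\notin\mathrm{Ext}(B_{J^*})$, $x_m^*\in\mathrm{Ext}(B_{J^*})$ for every $m\ge1$, and $\|x_m^*-x^*\|_*\to0$. 2. Let $F\subset\mathbb{N}$ be an initial segment (finite, or $F=\mathbb{N}$), let $(I_i)_{i\in F}$ be non-empty intervals of $\mathbb{N}$ with $\max I_i<\min I_{i+1}$ whenever $i+1\in F$, let $\alpha_i\ne0$ for $i\in F$, and suppose that $x^*=\sum_{i\in F}\alpha_iI_i^*$ (norm-convergent) belongs to $\mathcal{D}_1\cap S_{J^*}$. Define the gap function $g_{x^*}:F\to\mathbb{N}$ by $g_{x^*}(i)=\min I_{i+1}-\max I_i-1$ if $i+1\in F$, and $g_{x^*}(i)=0$ if $i=\max F$. Then $$x^*\in\overline{\mathrm{Ext}(B_{J^*})}^{\|\cdot\|_*}\iff 1\notin g_{x^*}[F],$$ i.e.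 if and only if no two consecutive intervals are separated by exactly one point. -/

import Mathlib

open Filter Topology

noncomputable section

namespace James

/-! ### The James space -/

/-- The block sums `(∑ᵢ |∑_{k ∈ Iᵢ} x(k)|²)^{1/2}` of a real sequence `x`, over all finite families
of pairwise disjoint finite intervals `Iᵢ = [a i, b i]` of `ℕ` (empty ones contribute `0`). -/
def blockSums (x : ℕ → ℝ) : Set ℝ :=
  {r | ∃ (n : ℕ) (a b : Fin n → ℕ),
    (Pairwise fun i j => Disjoint (Finset.Icc (a i) (b i)) (Finset.Icc (a j) (b j))) ∧
    r = √(∑ i, |∑ k ∈ Finset.Icc (a i) (b i), x k| ^ 2)}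

/-- The James norm of a sequence (junk if the block sums are unbounded). -/
def jNorm (x : ℕ → ℝ) : ℝ := sSup (blockSums x)

theorem sqrt_eq_norm {n : ℕ} (v : Fin n → ℝ) :
    √(∑ i, |v i| ^ 2) = ‖WithLp.toLp 2 v‖ := by
  rw [EuclideanSpace.norm_eq]
  simp

theorem blockSums_nonempty (x : ℕ → ℝ) : (blockSums x).Nonempty :=
  ⟨_, 0, fun _ => 0, fun _ => 0, fun i => i.elim0, rfl⟩

theorem blockSums_zero_le {x : ℕ → ℝ} {r : ℝ} (hr : r ∈ blockSums x) : 0 ≤ r := by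
  obtain ⟨n, a, b, -, rfl⟩ := hr
  exact Real.sqrt_nonneg _

theorem jNorm_nonneg (x : ℕ → ℝ) : 0 ≤ jNorm x :=
  Real.sSup_nonneg fun _ hr => blockSums_zero_le hr

theorem blockSums_add_le {x y : ℕ → ℝ} (hx : BddAbove (blockSums x))
    (hy : BddAbove (blockSums y)) {r : ℝ} (hr : r ∈ blockSums (x + y)) :
    r ≤ jNorm x + jNorm y := by
  obtain ⟨n, a, b, hd, rfl⟩ := hr
  have h1 : √(∑ i, |∑ k ∈ Finset.Icc (a i) (b i), x k| ^ 2) ≤ jNorm x :=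
    le_csSup hx ⟨n, a, b, hd, rfl⟩
  have h2 : √(∑ i, |∑ k ∈ Finset.Icc (a i) (b i), y k| ^ 2) ≤ jNorm y :=
    le_csSup hy ⟨n, a, b, hd, rfl⟩
  refine le_trans ?_ (add_le_add h1 h2)
  rw [sqrt_eq_norm, sqrt_eq_norm, sqrt_eq_norm]
  refine le_trans (le_of_eq ?_) (norm_add_le _ _)
  congr 1
  ext i
  simp [Finset.sum_add_distrib]

theorem blockSums_smul_le {x : ℕ → ℝ} (c : ℝ) (hx : BddAbove (blockSums x))
    {r : ℝ} (hr : r ∈ blockSums (c • x)) : r ≤ |c| * jNorm x := by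
  obtain ⟨n, a, b, hd, rfl⟩ := hr
  have h1 : √(∑ i, |∑ k ∈ Finset.Icc (a i) (b i), x k| ^ 2) ≤ jNorm x :=
    le_csSup hx ⟨n, a, b, hd, rfl⟩
  refine le_trans (le_of_eq ?_) (mul_le_mul_of_nonneg_left h1 (abs_nonneg c))
  rw [sqrt_eq_norm, sqrt_eq_norm, ← Real.norm_eq_abs c, ← norm_smul]
  congr 1
  ext i
  simp [Finset.mul_sum]

theorem blockSums_zero {r : ℝ} (hr : r ∈ blockSums 0) : r = 0 := by
  obtain ⟨n, a, b, -, rfl⟩ := hr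
  simp

/-- The vector space of all real sequences of finite James norm. -/
def jSubmodule : Submodule ℝ (ℕ → ℝ) where
  carrier := {x | BddAbove (blockSums x)}
  add_mem' {_ _} hx hy := ⟨_, fun _ hr => blockSums_add_le hx hy hr⟩
  zero_mem' := ⟨0, fun _ hr => (blockSums_zero hr).le⟩
  smul_mem' c _ hx := ⟨_, fun _ hr => blockSums_smul_le c hx hr⟩

end James

/-- The James space `J`: the real sequences of finite James norm. (This is a plain `def`, so that it
carries the norm topology and not the topology of pointwise convergence.) -/
def JamesSpace : Type := James.jSubmodule

namespace James

instance : AddCommGroup JamesSpace := inferInstanceAs (AddCommGroup jSubmodule)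
instance : Module ℝ JamesSpace := inferInstanceAs (Module ℝ jSubmodule)
instance : CoeFun JamesSpace (fun _ => ℕ → ℝ) := ⟨fun x => x.1⟩

theorem coe_add (x y : JamesSpace) : ((x + y : JamesSpace) : ℕ → ℝ) = x + y := rfl
theorem coe_smul (c : ℝ) (x : JamesSpace) : ((c • x : JamesSpace) : ℕ → ℝ) = c • (x : ℕ → ℝ) := rfl

theorem block_le (x : JamesSpace) {n : ℕ} (a b : Fin n → ℕ)
    (hd : Pairwise fun i j => Disjoint (Finset.Icc (a i) (b i)) (Finset.Icc (a j) (b j))) :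
    √(∑ i, |∑ k ∈ Finset.Icc (a i) (b i), x k| ^ 2) ≤ jNorm x :=
  le_csSup x.2 ⟨n, a, b, hd, rfl⟩

theorem abs_sum_Icc_le (x : JamesSpace) (a b : ℕ) :
    |∑ k ∈ Finset.Icc a b, x k| ≤ jNorm x := by
  have h := block_le x (n := 1) (fun _ => a) (fun _ => b)
    (fun i j hij => (hij (Subsingleton.elim i j)).elim)
  simpa [Real.sqrt_sq_eq_abs] using h

instance : NormedAddCommGroup JamesSpace :=
  AddGroupNorm.toNormedAddCommGroup
    { toFun := fun x => jNorm x
      map_zero' := by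
        refine le_antisymm (csSup_le (blockSums_nonempty _) fun r hr => ?_) (jNorm_nonneg _)
        exact (blockSums_zero hr).le
      add_le' := fun x y =>
        csSup_le (blockSums_nonempty _) fun r hr => blockSums_add_le x.2 y.2 hr
      neg' := by
        have key : ∀ x : JamesSpace, jNorm (-x : JamesSpace) ≤ jNorm x := fun x => by
          refine csSup_le (blockSums_nonempty _) fun r hr => ?_
          have h := blockSums_smul_le (x := (x : ℕ → ℝ)) (-1) x.2 (r := r) (by
            rw [neg_one_smul]; exact hr)
          simpa using h
        intro x
        refine le_antisymm (key x) ?_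
        have h := key (-x)
        rwa [neg_neg] at h
      eq_zero_of_map_eq_zero' := fun x hx => by
        apply Subtype.ext
        funext k
        have h := abs_sum_Icc_le x k k
        rw [hx, Finset.Icc_self, Finset.sum_singleton] at h
        exact abs_nonpos_iff.1 h }

theorem norm_def (x : JamesSpace) : ‖x‖ = sSup (blockSums x) := rfl

instance : NormedSpace ℝ JamesSpace where
  norm_smul_le c x := csSup_le (blockSums_nonempty _) fun _ hr => blockSums_smul_le c x.2 hr

/-! ### Intervals and the functionals `I*` -/

end James

/-- A non-empty interval `{k : lo ≤ k ≤ hi}` of `ℕ`; it is infinite exactly if `hi = ⊤`. -/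
structure NatInterval where
  /-- the minimum of the interval -/
  lo : ℕ
  /-- the maximum of the interval, or `⊤` -/
  hi : ℕ∞
  lo_le_hi : (lo : ℕ∞) ≤ hi

namespace NatInterval

/-- The set of points of an interval. -/
def points (I : NatInterval) : Set ℕ := {k | I.lo ≤ k ∧ (k : ℕ∞) ≤ I.hi}

/-- The one-point interval `{n}`. -/
def single (n : ℕ) : NatInterval := ⟨n, n, le_rfl⟩

end NatInterval

namespace James

/-- `∑_{k ∈ I, k < N} x(k)`. -/
def partialSum (I : NatInterval) (x : JamesSpace) (N : ℕ) : ℝ :=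
  ∑ k ∈ Finset.range N, I.points.indicator (x : ℕ → ℝ) k

theorem sum_indicator_Ico (I : NatInterval) (x : JamesSpace) (m n : ℕ) :
    ∃ a b : ℕ, Finset.Icc a b ⊆ Finset.Ico m n ∧
      ∑ k ∈ Finset.Ico m n, I.points.indicator (x : ℕ → ℝ) k = ∑ k ∈ Finset.Icc a b, x k := by
  classical
  obtain ⟨lo, hi, h⟩ := I
  simp only [Set.indicator_apply, ← Finset.sum_filter]
  rcases Nat.eq_zero_or_pos n with rfl | hn
  · exact ⟨1, 0, by simp, by simp⟩
  induction hi using ENat.recTopCoe with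
  | top =>
    refine ⟨max m lo, n - 1, fun k hk => ?_, Finset.sum_congr ?_ fun _ _ => rfl⟩
    · simp only [Finset.mem_Icc, Finset.mem_Ico] at *
      omega
    · ext k
      simp only [Finset.mem_filter, Finset.mem_Icc, Finset.mem_Ico, NatInterval.points,
        Set.mem_ofPred_eq, le_top, and_true]
      omega
  | coe hi =>
    refine ⟨max m lo, min (n - 1) hi, fun k hk => ?_, Finset.sum_congr ?_ fun _ _ => rfl⟩
    · simp only [Finset.mem_Icc, Finset.mem_Ico] at *
      omega
    · ext k
      simp only [Finset.mem_filter, Finset.mem_Icc, Finset.mem_Ico, NatInterval.points,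
        Set.mem_ofPred_eq, Nat.cast_le]
      omega

theorem abs_partialSum_le (I : NatInterval) (x : JamesSpace) (N : ℕ) :
    |partialSum I x N| ≤ ‖x‖ := by
  obtain ⟨a, b, -, h⟩ := sum_indicator_Ico I x 0 N
  rw [partialSum, Finset.range_eq_Ico, h]
  exact abs_sum_Icc_le x a b

/-- The series `∑_{k ∈ I} x(k)` converges for every `x` in the James space. -/
theorem cauchySeq_partialSum (I : NatInterval) (x : JamesSpace) :
    CauchySeq (partialSum I x) := by
  by_contra hc
  rw [Metric.cauchySeq_iff'] at hc
  push Not at hc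
  obtain ⟨ε, hε, H⟩ := hc
  have step : ∀ N : ℕ, ∃ p : ℕ × ℕ × ℕ, N ≤ p.1 ∧ Finset.Icc p.1 p.2.1 ⊆ Finset.Ico N p.2.2 ∧
      N ≤ p.2.2 ∧ ε ≤ |∑ k ∈ Finset.Icc p.1 p.2.1, x k| := by
    intro N
    obtain ⟨n, hn, hd⟩ := H N
    obtain ⟨a, b, hab, hs⟩ := sum_indicator_Ico I x N n
    rw [Real.dist_eq, partialSum, partialSum, ← Finset.sum_Ico_eq_sub _ hn, hs] at hd
    have hne : (Finset.Icc a b).Nonempty := by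
      by_contra h
      rw [Finset.not_nonempty_iff_eq_empty] at h
      rw [h] at hd
      simp at hd
      linarith
    have ha := hab (Finset.left_mem_Icc.2 (Finset.nonempty_Icc.1 hne))
    exact ⟨(a, b, n), (Finset.mem_Ico.1 ha).1, hab, hn, hd⟩
  choose p hp1 hp2 hp3 hp4 using step
  let s : ℕ → ℕ := fun j => Nat.rec 0 (fun _ N => (p N).2.2) j
  have hs : ∀ j, s (j + 1) = (p (s j)).2.2 := fun j => rfl
  have hmono : Monotone s := monotone_nat_of_le_succ fun j => by rw [hs]; exact hp3 _
  have hdisj : ∀ i j, i < j →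
      Disjoint (Finset.Icc (p (s i)).1 (p (s i)).2.1) (Finset.Icc (p (s j)).1 (p (s j)).2.1) := by
    intro i j hij
    refine Finset.disjoint_left.2 fun k h1 h2 => ?_
    have h1' := Finset.mem_Ico.1 (hp2 _ h1)
    have h2' := Finset.mem_Ico.1 (hp2 _ h2)
    have h3 : s (i + 1) ≤ s j := hmono hij
    rw [hs] at h3
    omega
  obtain ⟨n, hn⟩ := exists_nat_gt (‖x‖ ^ 2 / ε ^ 2)
  have hb := block_le x (n := n) (fun i => (p (s i)).1) (fun i => (p (s i)).2.1) (by
    intro i j hij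
    rcases lt_or_gt_of_ne (fun h => hij (Fin.ext h) : (i : ℕ) ≠ j) with h | h
    · exact hdisj _ _ h
    · exact (hdisj _ _ h).symm)
  change _ ≤ ‖x‖ at hb
  rw [Real.sqrt_le_left (norm_nonneg x)] at hb
  have hl : (n : ℝ) * ε ^ 2 ≤
      ∑ i : Fin n, |∑ k ∈ Finset.Icc (p (s i)).1 (p (s i)).2.1, x k| ^ 2 := by
    have := Finset.card_nsmul_le_sum (Finset.univ : Finset (Fin n))
      (fun i => |∑ k ∈ Finset.Icc (p (s i)).1 (p (s i)).2.1, x k| ^ 2) (ε ^ 2)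
      (fun i _ => pow_le_pow_left₀ hε.le (hp4 _) 2)
    simpa using this
  rw [div_lt_iff₀ (by positivity)] at hn
  linarith

theorem tendsto_partialSum (I : NatInterval) (x : JamesSpace) :
    Tendsto (partialSum I x) atTop (𝓝 (limUnder atTop (partialSum I x))) :=
  (cauchySeq_partialSum I x).tendsto_limUnder

/-- The functional `I*` of the dual of the James space: `I*(x) = ∑_{k ∈ I} x(k)`, where the sum of
an infinite series is the limit of its partial sums. -/
def intervalFunctional (I : NatInterval) : StrongDual ℝ JamesSpace :=
  LinearMap.mkContinuous
    { toFun := fun x => limUnder atTop (partialSum I x)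
      map_add' := fun x y => by
        refine (((tendsto_partialSum I x).add (tendsto_partialSum I y)).congr fun N => ?_).limUnder_eq
        simp only [partialSum, coe_add, Set.indicator_add', Pi.add_apply, Finset.sum_add_distrib]
      map_smul' := fun c x => by
        refine (((tendsto_partialSum I x).const_mul c).congr fun N => ?_).limUnder_eq
        simp only [partialSum, coe_smul, Finset.mul_sum]
        refine Finset.sum_congr rfl fun k _ => ?_
        by_cases hk : k ∈ I.points <;> simp [hk] }
    1 (fun x => by
      rw [one_mul]
      exact le_of_tendsto (tendsto_partialSum I x).norm
        (Eventually.of_forall fun N => abs_partialSum_le I x N))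

/-- The functional `eₙ*(x) = x(n)`, which is `I*` for `I = {n}`. -/
def coordFunctional (n : ℕ) : StrongDual ℝ JamesSpace := intervalFunctional (NatInterval.single n)

theorem coordFunctional_apply (n : ℕ) (x : JamesSpace) : coordFunctional n x = x n := by
  refine (tendsto_const_nhds.congr' ?_).limUnder_eq
  filter_upwards [eventually_gt_atTop n] with N hN
  have h : (NatInterval.single n).points = {n} := by
    ext k
    simp only [NatInterval.points, NatInterval.single, Set.mem_ofPred_eq, Nat.cast_le,
      Set.mem_singleton_iff]
    omega
  rw [partialSum, h, Finset.sum_eq_single n (by simp +contextual)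
    (fun h => (h (Finset.mem_range.2 hN)).elim)]
  simp

/-! ### The sets `𝒟`, `𝒟₁` and the extreme points of the dual ball -/

/-- The set `𝒟` of all `∑_{i < k} aᵢ Iᵢ*` with pairwise disjoint finite intervals `Iᵢ` and
`(∑ aᵢ²)^{1/2} ≤ 1`. -/
def setD : Set (StrongDual ℝ JamesSpace) :=
  {f | ∃ (k : ℕ) (I : Fin k → NatInterval) (a : Fin k → ℝ),
    (∀ i, (I i).hi ≠ ⊤) ∧ (Pairwise fun i j => Disjoint (I i).points (I j).points) ∧
    √(∑ i, a i ^ 2) ≤ 1 ∧ f = ∑ i, a i • intervalFunctional (I i)}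

/-- The set `𝒟₁`: the weak-star closure of `𝒟` in the dual of the James space. -/
def setD₁ : Set (StrongDual ℝ JamesSpace) :=
  {f | StrongDual.toWeakDual f ∈ closure (StrongDual.toWeakDual '' setD)}

/-- The extreme points of the closed unit ball of the dual of the James space. -/
def extDualBall : Set (StrongDual ℝ JamesSpace) :=
  Set.extremePoints ℝ (Metric.closedBall (0 : StrongDual ℝ JamesSpace) 1)

/-- The gap function `g(i) = min I_{i+1} - max I_i - 1` if `i + 1 ∈ F`, and `g(i) = 0` if `i` is the
last element of `F`. It is used for `i ∈ F` and for families with `max I_i < min I_{i+1}` for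
`i + 1 ∈ F`, so that `max I_i` is finite and nothing is truncated. -/
def gapFunction (F : Set ℕ) (I : ℕ → NatInterval) (i : ℕ) : ℕ :=
  open Classical in
  if i + 1 ∈ F then (I (i + 1)).lo - (I i).hi.toNat - 1 else 0

end James

end

noncomputable section

namespace James

/-! ### Block sums -/

/-! The unit vectors form a Schauder basis of `J`, so a functional `f` is determined by its
coordinates `c = coords f`. Cut `ℕ` into the maximal runs on which `c` is constant, and let `Q(c)`
be the sum of the squares of the values, one for each run; this is the sum of `jumps c n ^ 2`.
Grouping the terms of `∑ c n * x n` by runs and applying Cauchy-Schwarz gives `‖f‖ ^ 2 ≤ Q(c)`. On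
`setD` one has `Q ≤ 1`, and `Q` is lower semicontinuous for coordinatewise convergence, so `Q ≤ 1`
on `setD₁`. Since `setD` is norming, Hahn-Banach and Milman's theorem place every extreme point of
the dual ball in `setD₁`.

If moreover `‖f‖ = 1`, then `Q(c) = 1`, and `jumps c` is block dominated (`blockDominated_jumps`):
merging neighbouring blocks of an almost norming vector must not increase its norm. Thus `jumps c`
is itself a unit vector at which `f` attains its norm, and the values of `c` on the two sides of a
gap of zeros have opposite signs.

Necessity of the gap condition: a coordinate of an extreme point never lies strictly between its two
neighbours, for it could be moved to either of them without raising `Q` above `1`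
(`not_mem_extDualBall`). Lying strictly between is an open condition, and it holds at a gap of
length one because of the opposite signs.

Sufficiency: a functional with `Q = 1`, block dominated jumps and no gaps is extreme
(`mem_extDualBall`), since a decreasing sequence of faces isolates it coordinate by coordinate. Let
`a` and `b` be the values around a gap of length at least two. Filling the gap with the small values
`-θ a|b|, θ a|b|, …, θ a|b|` makes the signs alternate from `a` to `b` and preserves block
domination (`blockDominated_add_smul_fill`); after normalisation this gives extreme points which
tend to `f` as `θ → 0`. The explicit sequence `x_m*` is an instance of the same pattern. -/

theorem exists_eq_Icc (A : Finset ℕ)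
    (h : ∀ a ∈ A, ∀ b ∈ A, ∀ k, a ≤ k → k ≤ b → k ∈ A) : ∃ u v, A = Finset.Icc u v := by
  rcases A.eq_empty_or_nonempty with rfl | hA
  · exact ⟨1, 0, by simp⟩
  · refine ⟨A.min' hA, A.max' hA, ?_⟩
    ext k
    rw [Finset.mem_Icc]
    exact ⟨fun hk => ⟨A.min'_le _ hk, A.le_max' _ hk⟩,
      fun hk => h _ (A.min'_mem hA) _ (A.max'_mem hA) k hk.1 hk.2⟩

theorem sum_block_sq_le (x : JamesSpace) {ι : Type*} (A : Finset ι) (s : ι → Finset ℕ)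
    (hs : ∀ i ∈ A, ∃ u v, s i = Finset.Icc u v)
    (hd : ∀ i ∈ A, ∀ j ∈ A, i ≠ j → Disjoint (s i) (s j)) :
    ∑ i ∈ A, (∑ k ∈ s i, x k) ^ 2 ≤ ‖x‖ ^ 2 := by
  have hs' : ∀ i : Fin A.card, ∃ u v, s (A.equivFin.symm i) = Finset.Icc u v :=
    fun i => hs _ (A.equivFin.symm i).2
  choose a b hab using hs'
  have h := block_le x a b (fun i j hij => by
    simp only [← hab]
    exact hd _ (A.equivFin.symm i).2 _ (A.equivFin.symm j).2
      (fun h => hij (A.equivFin.symm.injective (Subtype.ext h))))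
  change _ ≤ ‖x‖ at h
  rw [Real.sqrt_le_left (norm_nonneg x)] at h
  refine le_trans (le_of_eq ?_) h
  rw [← Finset.sum_coe_sort, ← A.equivFin.symm.sum_comp]
  exact Finset.sum_congr rfl fun i _ => by rw [hab, sq_abs]

theorem exists_norm_sq_lt (x : JamesSpace) {ε : ℝ} (hε : 0 < ε) :
    ∃ (n : ℕ) (a b : Fin n → ℕ),
      (Pairwise fun i j => Disjoint (Finset.Icc (a i) (b i)) (Finset.Icc (a j) (b j))) ∧
      ‖x‖ ^ 2 - ε < ∑ i, (∑ k ∈ Finset.Icc (a i) (b i), x k) ^ 2 := by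
  by_contra! hc
  -- The empty family has block sum `0`; without this bound the square root below would be a default
  -- value.
  have h0 : 0 ≤ ‖x‖ ^ 2 - ε := by
    simpa using hc 0 (fun _ => 0) (fun _ => 0) (fun i => i.elim0)
  have h1 : ‖x‖ ≤ √(‖x‖ ^ 2 - ε) := by
    refine csSup_le (blockSums_nonempty _) ?_
    rintro _ ⟨n, a, b, hd, rfl⟩
    simp only [sq_abs]
    exact Real.sqrt_le_sqrt (hc n a b hd)
  have h2 := pow_le_pow_left₀ (norm_nonneg x) h1 2
  rw [Real.sq_sqrt h0] at h2
  linarith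

theorem norm_sq_le (x : JamesSpace) {B : ℝ}
    (h : ∀ (n : ℕ) (a b : Fin n → ℕ),
      (Pairwise fun i j => Disjoint (Finset.Icc (a i) (b i)) (Finset.Icc (a j) (b j))) →
      ∑ i, (∑ k ∈ Finset.Icc (a i) (b i), x k) ^ 2 ≤ B) : ‖x‖ ^ 2 ≤ B := by
  refine le_of_forall_pos_le_add fun ε hε => ?_
  obtain ⟨n, a, b, hd, hlt⟩ := exists_norm_sq_lt x hε
  linarith [h n a b hd]

/-- The fibres of a monotone map are disjoint intervals. This form makes it easy to pass to coarser
partitions, by composing with another monotone map. -/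
theorem sum_fiber_sq_le (x : JamesSpace) {φ : ℕ → ℕ} (hφ : Monotone φ) (A : Finset ℕ) (N : ℕ) :
    ∑ s ∈ A, (∑ n ∈ Finset.range N with φ n = s, x n) ^ 2 ≤ ‖x‖ ^ 2 := by
  refine sum_block_sq_le x A (fun s => Finset.range N |>.filter (φ · = s)) (fun s _ => ?_) ?_
  · refine exists_eq_Icc _ fun a ha b hb k hak hkb => ?_
    simp only [Finset.mem_filter, Finset.mem_range] at *
    have h1 := hφ hak
    have h2 := hφ hkb
    omega
  · intro i _ j _ hij
    refine Finset.disjoint_left.2 fun k h1 h2 => hij ?_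
    simp only [Finset.mem_filter] at h1 h2
    exact h1.2.symm.trans h2.2

/-- Every interval sum of `z` is dominated by the euclidean norm of `z` on the interval. -/
def BlockDominated (z : ℕ → ℝ) : Prop :=
  ∀ u v, (∑ k ∈ Finset.Icc u v, z k) ^ 2 ≤ ∑ k ∈ Finset.Icc u v, z k ^ 2

theorem BlockDominated.sq_sum_le {z : ℕ → ℝ} (hz : BlockDominated z) (A : Finset ℕ)
    (h : ∀ a ∈ A, ∀ b ∈ A, ∀ k, a ≤ k → k ≤ b → k ∈ A) :
    (∑ k ∈ A, z k) ^ 2 ≤ ∑ k ∈ A, z k ^ 2 := by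
  obtain ⟨u, v, rfl⟩ := exists_eq_Icc A h
  exact hz u v

theorem BlockDominated.sum_blocks_le {z : ℕ → ℝ} (hz : BlockDominated z) {B : ℝ}
    (hB : ∀ N, ∑ k ∈ Finset.range N, z k ^ 2 ≤ B) {n : ℕ} (a b : Fin n → ℕ)
    (hd : Pairwise fun i j => Disjoint (Finset.Icc (a i) (b i)) (Finset.Icc (a j) (b j))) :
    ∑ i, (∑ k ∈ Finset.Icc (a i) (b i), z k) ^ 2 ≤ B := by
  refine (Finset.sum_le_sum fun i _ => hz (a i) (b i)).trans ?_
  rw [← Finset.sum_biUnion (fun i _ j _ hij => hd hij)]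
  refine le_trans (Finset.sum_le_sum_of_subset_of_nonneg (t := Finset.range
    (Finset.univ.sup b + 1)) ?_ fun _ _ _ => sq_nonneg _) (hB _)
  intro k hk
  simp only [Finset.mem_biUnion, Finset.mem_univ, true_and, Finset.mem_Icc] at hk
  obtain ⟨i, -, hi⟩ := hk
  have : b i ≤ Finset.univ.sup b := Finset.le_sup (Finset.mem_univ i)
  exact Finset.mem_range.2 (by omega)

theorem BlockDominated.exists_jamesSpace {z : ℕ → ℝ} (hz : BlockDominated z) {B : ℝ}
    (hB : ∀ N, ∑ k ∈ Finset.range N, z k ^ 2 ≤ B) :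
    ∃ x : JamesSpace, (x : ℕ → ℝ) = z ∧ ‖x‖ ^ 2 ≤ B := by
  have hmem : z ∈ jSubmodule := by
    refine ⟨√B, ?_⟩
    rintro _ ⟨n, a, b, hd, rfl⟩
    simp only [sq_abs]
    exact Real.sqrt_le_sqrt (hz.sum_blocks_le hB a b hd)
  exact ⟨⟨z, hmem⟩, rfl, norm_sq_le _ fun n a b hd => hz.sum_blocks_le hB a b hd⟩

/-! ### Unit vectors and truncations -/

theorem single_one_sq (n k : ℕ) :
    (Pi.single n (1 : ℝ) : ℕ → ℝ) k ^ 2 = (Pi.single n (1 : ℝ) : ℕ → ℝ) k := by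
  by_cases h : k = n
  · subst h; simp
  · simp [h]

theorem blockDominated_single (n : ℕ) : BlockDominated (Pi.single n 1) := by
  intro u v
  rw [Finset.sum_congr rfl fun k _ => single_one_sq n k, Finset.sum_pi_single']
  split_ifs <;> norm_num

theorem exists_unitVec (n : ℕ) : ∃ x : JamesSpace, (x : ℕ → ℝ) = Pi.single n 1 ∧ ‖x‖ ^ 2 ≤ 1 := by
  refine (blockDominated_single n).exists_jamesSpace fun N => ?_
  rw [Finset.sum_congr rfl fun k _ => single_one_sq n k, Finset.sum_pi_single']
  split_ifs <;> norm_num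

/-- The `n`-th unit vector of the James space. -/
def unitVec (n : ℕ) : JamesSpace := (exists_unitVec n).choose

theorem unitVec_coe (n : ℕ) : (unitVec n : ℕ → ℝ) = Pi.single n 1 :=
  (exists_unitVec n).choose_spec.1

/-- The `N`-th partial sum of the unit vector expansion of `x`. -/
def trunc (x : JamesSpace) (N : ℕ) : JamesSpace := ∑ n ∈ Finset.range N, x n • unitVec n

theorem coe_sum {ι : Type*} (A : Finset ι) (g : ι → JamesSpace) :
    ((∑ i ∈ A, g i : JamesSpace) : ℕ → ℝ) = ∑ i ∈ A, (g i : ℕ → ℝ) :=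
  map_sum (jSubmodule.subtype : jSubmodule →ₗ[ℝ] (ℕ → ℝ)) (g : ι → jSubmodule) A

theorem coe_sub (x y : JamesSpace) : ((x - y : JamesSpace) : ℕ → ℝ) = x - y := rfl

theorem trunc_apply (x : JamesSpace) (N k : ℕ) : trunc x N k = if k < N then x k else 0 := by
  rw [trunc, coe_sum, Finset.sum_apply]
  simp only [coe_smul, unitVec_coe, Pi.smul_apply, smul_eq_mul]
  by_cases h : k < N
  · rw [if_pos h, Finset.sum_eq_single_of_mem k (Finset.mem_range.2 h)]
    · simp
    · intro j _ hj
      simp [hj.symm]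
  · rw [if_neg h]
    refine Finset.sum_eq_zero fun j hj => ?_
    have : k ≠ j := by have := Finset.mem_range.1 hj; omega
    simp [this]

theorem apply_trunc (f : StrongDual ℝ JamesSpace) (x : JamesSpace) (N : ℕ) :
    f (trunc x N) = ∑ n ∈ Finset.range N, f (unitVec n) * x n := by
  rw [trunc, map_sum]
  exact Finset.sum_congr rfl fun n _ => by rw [map_smul, smul_eq_mul, mul_comm]

/-- The unit vectors form a Schauder basis of the James space. -/
theorem tendsto_trunc (x : JamesSpace) : Tendsto (trunc x) atTop (𝓝 x) := by
  rw [Metric.tendsto_atTop]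
  intro ε hε
  obtain ⟨n, a, b, hd, hlt⟩ := exists_norm_sq_lt x (show 0 < ε ^ 2 / 2 by positivity)
  refine ⟨Finset.univ.sup b + 1, fun N hN => ?_⟩
  rw [dist_comm, dist_eq_norm]
  refine lt_of_pow_lt_pow_left₀ 2 hε.le (lt_of_le_of_lt ?_ (half_lt_self (pow_pos hε 2)))
  refine norm_sq_le _ fun m a' b' hd' => ?_
  -- Almost optimal blocks for `x`, all below `N`, are joined with arbitrary blocks of the tail. The
  -- total is at most `‖x‖ ^ 2`, so the tail blocks contribute at most `ε ^ 2 / 2`.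
  have key := sum_block_sq_le x (Finset.univ : Finset (Fin n ⊕ Fin m))
    (Sum.elim (fun i => Finset.Icc (a i) (b i)) fun j => (Finset.Icc (a' j) (b' j)).filter (¬ · < N))
    (by
      rintro (i | j) -
      · exact ⟨_, _, rfl⟩
      · refine exists_eq_Icc _ fun p hp q hq k h1 h2 => ?_
        simp only [Sum.elim_inr, Finset.mem_filter, Finset.mem_Icc] at *
        omega)
    (by
      have hb : ∀ i, b i ≤ Finset.univ.sup b := fun i => Finset.le_sup (Finset.mem_univ i)
      have hdis : ∀ i j, Disjoint (Finset.Icc (a i) (b i))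
          ((Finset.Icc (a' j) (b' j)).filter (¬ · < N)) := fun i j => by
        refine Finset.disjoint_left.2 fun k h1 h2 => ?_
        simp only [Finset.mem_filter, Finset.mem_Icc] at *
        have := hb i
        omega
      rintro (i | i) - (j | j) - hij
      · exact hd (fun h => hij (congrArg _ h))
      · exact hdis i j
      · exact (hdis j i).symm
      · exact Finset.disjoint_filter_filter (hd' fun h => hij (congrArg _ h)))
  rw [Fintype.sum_sum_type] at key
  simp only [Sum.elim_inl, Sum.elim_inr] at key
  have h2 : ∀ j, ∑ k ∈ Finset.Icc (a' j) (b' j), (x - trunc x N : JamesSpace) k =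
      ∑ k ∈ (Finset.Icc (a' j) (b' j)).filter (¬ · < N), x k := fun j => by
    rw [Finset.sum_filter]
    refine Finset.sum_congr rfl fun k _ => ?_
    rw [coe_sub, Pi.sub_apply, trunc_apply]
    split_ifs <;> simp_all
  simp only [h2]
  linarith

/-! ### Coordinates of functionals -/

/-- The coordinates of a functional with respect to the unit vectors. -/
def coords (f : StrongDual ℝ JamesSpace) (n : ℕ) : ℝ := f (unitVec n)

theorem tendsto_sum_coords (f : StrongDual ℝ JamesSpace) (x : JamesSpace) :
    Tendsto (fun N => ∑ n ∈ Finset.range N, coords f n * x n) atTop (𝓝 (f x)) :=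
  ((f.continuous.tendsto x).comp (tendsto_trunc x)).congr fun N => apply_trunc f x N

theorem coords_injective : Function.Injective coords := fun f g h => by
  ext x
  refine tendsto_nhds_unique (tendsto_sum_coords f x) ?_
  rw [h]
  exact tendsto_sum_coords g x

theorem coords_add (f g : StrongDual ℝ JamesSpace) : coords (f + g) = coords f + coords g := rfl
theorem coords_sub (f g : StrongDual ℝ JamesSpace) : coords (f - g) = coords f - coords g := rfl
theorem coords_smul (r : ℝ) (f : StrongDual ℝ JamesSpace) : coords (r • f) = r • coords f := rfl

theorem abs_coords_le (f : StrongDual ℝ JamesSpace) (n : ℕ) : |coords f n| ≤ ‖f‖ := by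
  have h : ‖unitVec n‖ ≤ 1 := by
    have := (exists_unitVec n).choose_spec.2
    exact (sq_le_one_iff₀ (norm_nonneg _)).1 this
  have := f.le_opNorm (unitVec n)
  rw [Real.norm_eq_abs] at this
  exact this.trans (mul_le_of_le_one_right (norm_nonneg f) h)

theorem coords_coordFunctional (n : ℕ) : coords (coordFunctional n) = Pi.single n 1 := by
  funext k
  rw [coords, coordFunctional_apply, unitVec_coe]
  by_cases h : k = n
  · subst h; simp
  · simp [h, Ne.symm h]

theorem coords_intervalFunctional (I : NatInterval) (n : ℕ) :
    coords (intervalFunctional I) n = I.points.indicator 1 n := by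
  refine (tendsto_const_nhds.congr' ?_).limUnder_eq
  filter_upwards [eventually_gt_atTop n] with N hN
  rw [partialSum, Finset.sum_eq_single_of_mem n (Finset.mem_range.2 hN)]
  · by_cases h : n ∈ I.points <;> simp [h, unitVec_coe]
  · intro k _ hk
    simp [unitVec_coe, hk]

/-! ### Runs of constant value -/

/-- The first point of the maximal interval ending with `n` on which `c` is constant. -/
def runStart (c : ℕ → ℝ) : ℕ → ℕ
  | 0 => 0
  | n + 1 => if c (n + 1) = c n then runStart c n else n + 1

theorem runStart_le (c : ℕ → ℝ) (n : ℕ) : runStart c n ≤ n := by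
  induction n with
  | zero => rfl
  | succ n ih => rw [runStart]; split_ifs <;> omega

theorem runStart_mono (c : ℕ → ℝ) : Monotone (runStart c) := by
  refine monotone_nat_of_le_succ fun n => ?_
  rw [runStart]
  split_ifs
  · rfl
  · exact (runStart_le c n).trans n.le_succ

theorem apply_runStart (c : ℕ → ℝ) (n : ℕ) : c (runStart c n) = c n := by
  induction n with
  | zero => rfl
  | succ n ih => rw [runStart]; split_ifs with h <;> simp_all

theorem runStart_runStart (c : ℕ → ℝ) (n : ℕ) : runStart c (runStart c n) = runStart c n := by
  induction n with
  | zero => rfl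
  | succ n ih =>
    by_cases h : c (n + 1) = c n
    · rwa [runStart, if_pos h]
    · simp only [runStart, if_neg h]

theorem runStart_eq_of_between {c : ℕ → ℝ} {k n : ℕ} (h1 : runStart c n ≤ k) (h2 : k ≤ n) :
    runStart c k = runStart c n :=
  le_antisymm (runStart_mono c h2) (by
    simpa only [runStart_runStart] using runStart_mono c h1)

/-- The sequence which is `c n` if `c` starts a new value at `n`, and `0` otherwise. -/
def jumps (c : ℕ → ℝ) (n : ℕ) : ℝ := if runStart c n = n then c n else 0

theorem jumps_zero (c : ℕ → ℝ) : jumps c 0 = c 0 := by simp [jumps, runStart]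

theorem jumps_succ (c : ℕ → ℝ) (n : ℕ) :
    jumps c (n + 1) = if c (n + 1) = c n then 0 else c (n + 1) := by
  have := runStart_le c n
  by_cases h : c (n + 1) = c n
  · rw [jumps, runStart, if_pos h, if_pos h, if_neg (by omega)]
  · rw [jumps, runStart, if_neg h, if_neg h, if_pos rfl]

theorem jumps_runStart (c : ℕ → ℝ) (n : ℕ) : jumps c (runStart c n) = c n := by
  rw [jumps, if_pos (runStart_runStart c n), apply_runStart c n]

theorem jumps_congr {c d : ℕ → ℝ} {n : ℕ} (h : ∀ k ≤ n, c k = d k) : jumps c n = jumps d n := by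
  cases n with
  | zero => simp [jumps_zero, h]
  | succ n => simp only [jumps_succ, h (n + 1) le_rfl, h n (by omega)]

theorem jumps_smul (r : ℝ) (c : ℕ → ℝ) : jumps (r • c) = r • jumps c := by
  funext n
  cases n with
  | zero => simp [jumps_zero]
  | succ n =>
    by_cases hr : r = 0
    · simp [jumps_succ, hr]
    · simp [jumps_succ, hr]

/-- The sum of `y` over the part below `N` of the run of `c` which starts at `s`. -/
def runSum (c y : ℕ → ℝ) (N s : ℕ) : ℝ := ∑ n ∈ Finset.range N with runStart c n = s, y n

theorem sum_mul_eq_sum_jumps (c y : ℕ → ℝ) (N : ℕ) :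
    ∑ n ∈ Finset.range N, c n * y n = ∑ s ∈ Finset.range N, jumps c s * runSum c y N s := by
  rw [← Finset.sum_fiberwise_of_maps_to (s := Finset.range N) (t := Finset.range N)
    (g := runStart c) (fun n hn => Finset.mem_range.2
      ((runStart_le c n).trans_lt (Finset.mem_range.1 hn)))]
  refine Finset.sum_congr rfl fun s _ => ?_
  rw [runSum, Finset.mul_sum]
  refine Finset.sum_congr rfl fun n hn => ?_
  rw [← (Finset.mem_filter.1 hn).2, jumps_runStart]

/-- The runs of `c` are disjoint intervals, hence an admissible family in the James norm. -/
theorem sum_runSum_sq_le (c : ℕ → ℝ) (x : JamesSpace) (N : ℕ) :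
    ∑ s ∈ Finset.range N, runSum c x N s ^ 2 ≤ ‖x‖ ^ 2 :=
  sum_fiber_sq_le x (runStart_mono c) _ N

theorem abs_sum_mul_le {c : ℕ → ℝ} {B : ℝ} (hB : ∀ N, ∑ n ∈ Finset.range N, jumps c n ^ 2 ≤ B)
    (x : JamesSpace) (N : ℕ) : |∑ n ∈ Finset.range N, c n * x n| ≤ √B * ‖x‖ := by
  rw [sum_mul_eq_sum_jumps]
  refine abs_le_of_sq_le_sq ?_ (by positivity)
  refine (Finset.sum_mul_sq_le_sq_mul_sq _ _ _).trans ?_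
  have h0 : 0 ≤ B := by simpa using hB 0
  rw [mul_pow, Real.sq_sqrt h0]
  exact mul_le_mul (hB N) (sum_runSum_sq_le c x N) (by positivity) h0

theorem norm_le_sqrt {f : StrongDual ℝ JamesSpace} {B : ℝ}
    (hB : ∀ N, ∑ n ∈ Finset.range N, jumps (coords f) n ^ 2 ≤ B) : ‖f‖ ≤ √B :=
  f.opNorm_le_bound (Real.sqrt_nonneg B) fun x =>
    le_of_tendsto (tendsto_sum_coords f x).norm
      (Eventually.of_forall fun N => abs_sum_mul_le hB x N)

/-! ### A converse of the Krein-Milman theorem -/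

section Milman

variable {E : Type*} [AddCommGroup E] [Module ℝ E] [TopologicalSpace E]
  [IsTopologicalAddGroup E] [ContinuousSMul ℝ E]

theorem isCompact_convexJoin {s t : Set E} (hs : IsCompact s) (ht : IsCompact t) :
    IsCompact (convexJoin ℝ s t) := by
  have h : convexJoin ℝ s t =
      (fun p : ℝ × E × E => (1 - p.1) • p.2.1 + p.1 • p.2.2) '' (Set.Icc 0 1 ×ˢ s ×ˢ t) := by
    ext x
    simp only [mem_convexJoin, Set.mem_image, Set.mem_prod, Prod.exists, segment_eq_image]
    constructor
    · rintro ⟨a, ha, b, hb, r, hr, rfl⟩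
      exact ⟨r, a, b, ⟨hr, ha, hb⟩, rfl⟩
    · rintro ⟨r, a, b, ⟨hr, ha, hb⟩, rfl⟩
      exact ⟨a, ha, b, hb, r, hr, rfl⟩
  rw [h]
  exact (isCompact_Icc.prod (hs.prod ht)).image (by fun_prop)

/-- The join of two compact convex sets is compact and convex, and it still misses `e`: an extreme
point on a segment inside `K` is an endpoint of that segment. Empty sets are treated apart because a
join with `∅` is empty. -/
theorem exists_compact_convex_union {K : Set E} (hconv : Convex ℝ K) {e : E}
    (he : e ∈ K.extremePoints ℝ) {ι : Type*} (A : Finset ι) (S : ι → Set E)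
    (hS : ∀ i ∈ A, IsCompact (S i) ∧ Convex ℝ (S i) ∧ S i ⊆ K ∧ e ∉ S i) :
    ∃ T, IsCompact T ∧ Convex ℝ T ∧ T ⊆ K ∧ e ∉ T ∧ ∀ i ∈ A, S i ⊆ T := by
  classical
  induction A using Finset.induction_on with
  | empty => exact ⟨∅, isCompact_empty, convex_empty, Set.empty_subset _, id, by simp⟩
  | insert i A _ ih =>
    obtain ⟨T, h1, h2, h3, h4, h5⟩ := ih fun j hj => hS j (Finset.mem_insert_of_mem hj)
    obtain ⟨g1, g2, g3, g4⟩ := hS i (Finset.mem_insert_self i A)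
    rcases T.eq_empty_or_nonempty with rfl | hT
    · refine ⟨S i, g1, g2, g3, g4, fun j hj => ?_⟩
      rcases Finset.mem_insert.1 hj with rfl | hj
      · rfl
      · exact (h5 j hj).trans (Set.empty_subset _)
    rcases (S i).eq_empty_or_nonempty with hi | hi
    · refine ⟨T, h1, h2, h3, h4, fun j hj => ?_⟩
      rcases Finset.mem_insert.1 hj with rfl | hj
      · simp [hi]
      · exact h5 j hj
    refine ⟨convexJoin ℝ (S i) T, isCompact_convexJoin g1 h1, g2.convexJoin h2,
      convexJoin_subset g3 h3 hconv, ?_, fun j hj => ?_⟩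
    · intro hmem
      obtain ⟨a, ha, b, hb, hab⟩ := mem_convexJoin.1 hmem
      rcases (mem_extremePoints_iff_forall_segment.1 he).2 a (g3 ha) b (h3 hb) hab with rfl | rfl
      · exact g4 ha
      · exact h4 hb
    · rcases Finset.mem_insert.1 hj with rfl | hj
      · exact subset_convexJoin_left hT
      · exact (h5 j hj).trans (subset_convexJoin_right hi)

/-- **Milman's theorem**: the extreme points of the closed convex hull of a compact set `A` belong
to `A`. -/
theorem extremePoints_subset_of_isCompact [T2Space E] [LocallyConvexSpace ℝ E] {K A : Set E}
    (hK : IsCompact K) (hconv : Convex ℝ K) (hA : IsCompact A) (hAK : A ⊆ K)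
    (hKA : K ⊆ closure (convexHull ℝ A)) : K.extremePoints ℝ ⊆ A := by
  intro e he
  by_contra heA
  have hsep : ∀ a : A, ∃ l : StrongDual ℝ E, l e < l a := fun a =>
    geometric_hahn_banach_point_point fun h => heA (h ▸ a.2)
  choose l hl using hsep
  -- Cutting at the midpoint of `l a e` and `l a a` leaves room for the closed half-space to contain
  -- a neighbourhood of `a` and still miss `e`.
  obtain ⟨t, ht⟩ := hA.elim_finite_subcover
    (fun a : A => {g | (l a e + l a a) / 2 < l a g})
    (fun a => isOpen_lt continuous_const (l a).continuous)
    (fun a ha => Set.mem_iUnion.2 ⟨⟨a, ha⟩, by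
      have := hl ⟨a, ha⟩
      simp only [Set.mem_ofPred_eq] at *
      linarith⟩)
  obtain ⟨T, h1, h2, -, h4, h5⟩ := exists_compact_convex_union hconv he t
    (fun a => K ∩ {g | (l a e + l a a) / 2 ≤ l a g}) (fun a _ => by
      have hcl : IsClosed {g | (l a e + l a a) / 2 ≤ l a g} :=
        isClosed_le continuous_const (l a).continuous
      refine ⟨hK.inter_right hcl, hconv.inter ?_, Set.inter_subset_left, fun h => ?_⟩
      · exact convex_halfSpace_ge (l a).isLinear _
      · have := hl a
        have h' := h.2
        simp only [Set.mem_ofPred_eq] at h'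
        linarith)
  have hAT : A ⊆ T := fun a ha => by
    obtain ⟨i, hi, hai⟩ := Set.mem_iUnion₂.1 (ht ha)
    have hai' : (l i e + l i i) / 2 < l i a := hai
    exact h5 i hi ⟨hAK ha, hai'.le⟩
  exact h4 (closure_minimal (convexHull_min hAT h2) h1.isClosed (hKA (extremePoints_subset he)))

end Milman

/-! ### The weak-star closure of `𝒟` -/

/-- A nonzero jump can only sit at the left end of one of the intervals, where it equals the
coefficient. Adjacent intervals with equal coefficients merge into one run, which only lowers the
sum. -/
theorem sum_jumps_sq_le_of_mem_setD {f : StrongDual ℝ JamesSpace} (hf : f ∈ setD) (N : ℕ) :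
    ∑ n ∈ Finset.range N, jumps (coords f) n ^ 2 ≤ 1 := by
  obtain ⟨k, I, a, -, hd, ha, rfl⟩ := hf
  rw [Real.sqrt_le_one] at ha
  set c := coords (∑ i, a i • intervalFunctional (I i)) with hc
  have hcoord : ∀ n, c n = ∑ j, a j * (I j).points.indicator 1 n := fun n => by
    rw [hc, coords, sum_apply]
    refine Finset.sum_congr rfl fun j _ => ?_
    rw [← coords_intervalFunctional]
    rfl
  have hcn : ∀ i, ∀ n ∈ (I i).points, c n = a i := by
    intro i n hn
    rw [hcoord, Finset.sum_eq_single i]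
    · simp [hn]
    · intro j _ hj
      rw [Set.indicator_of_notMem (fun h => Set.disjoint_left.1 (hd hj) h hn), mul_zero]
    · simp
  have hc0 : ∀ n, (∀ i, n ∉ (I i).points) → c n = 0 := by
    intro n hn
    rw [hcoord]
    exact Finset.sum_eq_zero fun j _ => by rw [Set.indicator_of_notMem (hn j), mul_zero]
  have hpt : ∀ n, jumps c n ^ 2 ≤ ∑ i, if (I i).lo = n then a i ^ 2 else 0 := by
    intro n
    have hnn : ∀ i ∈ (Finset.univ : Finset (Fin k)), 0 ≤ if (I i).lo = n then a i ^ 2 else 0 :=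
      fun i _ => by split_ifs <;> first | exact sq_nonneg _ | exact le_rfl
    by_cases hn : ∃ i, n ∈ (I i).points
    · obtain ⟨i, hi⟩ := hn
      by_cases hlo : (I i).lo = n
      · refine le_trans ?_ (Finset.single_le_sum hnn (Finset.mem_univ i))
        rw [if_pos hlo, jumps]
        split_ifs
        · rw [hcn i n hi]
        · simpa using sq_nonneg (a i)
      · have hlt : (I i).lo < n := lt_of_le_of_ne hi.1 hlo
        obtain ⟨m, rfl⟩ : ∃ m, n = m + 1 := ⟨n - 1, by omega⟩
        have hm : m ∈ (I i).points :=
          ⟨by omega, le_trans (by exact_mod_cast m.le_succ) hi.2⟩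
        rw [jumps_succ, if_pos ((hcn i _ hi).trans (hcn i _ hm).symm)]
        simpa using Finset.sum_nonneg hnn
    · push Not at hn
      rw [jumps, hc0 n hn, ite_self]
      simpa using Finset.sum_nonneg hnn
  refine (Finset.sum_le_sum fun n _ => hpt n).trans ?_
  rw [Finset.sum_comm]
  refine le_trans (Finset.sum_le_sum fun i _ => ?_) ha
  rw [Finset.sum_ite_eq]
  split_ifs
  · rfl
  · positivity

/-- Where two neighbouring coordinates agree the function takes its minimum `0`; where they differ
they do so on a neighbourhood, and there the function is a continuous square. -/
theorem lowerSemicontinuous_jumps_sq (n : ℕ) :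
    LowerSemicontinuous fun c : ℕ → ℝ => jumps c n ^ 2 := by
  cases n with
  | zero =>
    simp only [jumps_zero]
    exact ((continuous_apply 0).pow 2).lowerSemicontinuous
  | succ n =>
    intro c y hy
    simp only [jumps_succ] at hy ⊢
    by_cases h : c (n + 1) = c n
    · rw [if_pos h] at hy
      refine Eventually.of_forall fun d => lt_of_lt_of_le (b := 0) (by simpa using hy) ?_
      positivity
    · rw [if_neg h] at hy
      have h1 : ∀ᶠ d : ℕ → ℝ in 𝓝 c, d (n + 1) ≠ d n :=
        (isOpen_ne_fun (continuous_apply (n + 1)) (continuous_apply n)).mem_nhds h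
      have h2 : ∀ᶠ d : ℕ → ℝ in 𝓝 c, y < d (n + 1) ^ 2 :=
        (isOpen_lt continuous_const ((continuous_apply (n + 1)).pow 2)).mem_nhds hy
      filter_upwards [h1, h2] with d h1 h2
      rwa [if_neg h1]

theorem continuous_coords_weak :
    Continuous fun g : WeakDual ℝ JamesSpace => coords (WeakDual.toStrongDual g) :=
  continuous_pi fun n => WeakDual.eval_continuous (unitVec n)

theorem sum_jumps_sq_le_of_mem_setD₁ {f : StrongDual ℝ JamesSpace} (hf : f ∈ setD₁) (N : ℕ) :
    ∑ n ∈ Finset.range N, jumps (coords f) n ^ 2 ≤ 1 := by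
  have hcl := ((lowerSemicontinuous_sum fun n (_ : n ∈ Finset.range N) =>
    lowerSemicontinuous_jumps_sq n).isClosed_preimage 1).preimage continuous_coords_weak
  refine closure_minimal ?_ hcl hf
  rintro _ ⟨g, hg, rfl⟩
  exact sum_jumps_sq_le_of_mem_setD hg N

instance : LocallyConvexSpace ℝ (WeakDual ℝ JamesSpace) :=
  inferInstanceAs (LocallyConvexSpace ℝ (WeakBilin (topDualPairing ℝ JamesSpace)))

theorem setD_subset_closedBall : setD ⊆ Metric.closedBall 0 1 := fun f hf => by
  rw [mem_closedBall_zero_iff]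
  simpa using norm_le_sqrt (sum_jumps_sq_le_of_mem_setD hf)

theorem intervalFunctional_Icc {a b : ℕ} (h : (a : ℕ∞) ≤ (b : ℕ)) (x : JamesSpace) :
    intervalFunctional ⟨a, b, h⟩ x = ∑ k ∈ Finset.Icc a b, x k := by
  classical
  refine (tendsto_const_nhds.congr' ?_).limUnder_eq
  filter_upwards [eventually_gt_atTop b] with N hN
  rw [partialSum, Finset.sum_indicator_eq_sum_filter]
  refine Finset.sum_congr ?_ fun _ _ => rfl
  ext k
  simp only [Finset.mem_filter, Finset.mem_range, Finset.mem_Icc, NatInterval.points,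
    Set.mem_ofPred_eq, Nat.cast_le]
  omega

theorem exists_mem_setD_lt (x : JamesSpace) {r : ℝ} (hr : r < ‖x‖) : ∃ f ∈ setD, r < f x := by
  rcases lt_or_ge r 0 with h0 | h0
  · refine ⟨0, ⟨0, fun i => i.elim0, fun i => i.elim0, fun i => i.elim0, fun i => i.elim0,
      by simp, by simp⟩, by simpa using h0⟩
  · obtain ⟨n, a, b, hd, hlt⟩ := exists_norm_sq_lt x
      (ε := ‖x‖ ^ 2 - r ^ 2) (by nlinarith)
    -- Empty blocks are discarded because a `NatInterval` is non-empty. The coefficients are the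
    -- block sums divided by `√T`, the equality case of Cauchy-Schwarz.
    set A : Finset (Fin n) := Finset.univ.filter fun i => a i ≤ b i with hA
    set T : ℝ := ∑ i, (∑ k ∈ Finset.Icc (a i) (b i), x k) ^ 2 with hT
    have hTA : T = ∑ i ∈ A, (∑ k ∈ Finset.Icc (a i) (b i), x k) ^ 2 := by
      rw [hT, hA, Finset.sum_filter]
      refine Finset.sum_congr rfl fun i _ => ?_
      split_ifs with h
      · rfl
      · rw [Finset.Icc_eq_empty h]; simp
    have hT0 : 0 < T := by nlinarith
    let e := A.equivFin
    have hab : ∀ i : Fin A.card, (a (e.symm i) : ℕ∞) ≤ (b (e.symm i) : ℕ) := fun i => by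
      exact_mod_cast (Finset.mem_filter.1 (e.symm i).2).2
    have hsum : ∀ g : Fin n → ℝ, ∑ i : Fin A.card, g (e.symm i) = ∑ i ∈ A, g i := fun g => by
      rw [← Finset.sum_coe_sort A, ← e.symm.sum_comp]
    refine ⟨∑ i : Fin A.card, ((∑ k ∈ Finset.Icc (a (e.symm i)) (b (e.symm i)), x k) / √T) •
        intervalFunctional ⟨a (e.symm i), b (e.symm i), hab i⟩,
      ⟨A.card, _, _, fun i => ENat.natCast_ne_top _, fun i j hij => ?_, ?_, rfl⟩, ?_⟩
    · have h1 : Disjoint (Finset.Icc (a (e.symm i)) (b (e.symm i)))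
          (Finset.Icc (a (e.symm j)) (b (e.symm j))) :=
        hd fun h => hij (e.symm.injective (Subtype.ext h))
      refine Set.disjoint_left.2 fun k h2 h3 => Finset.disjoint_left.1 h1
        (Finset.mem_Icc.2 ⟨h2.1, Nat.cast_le.1 h2.2⟩)
        (Finset.mem_Icc.2 ⟨h3.1, Nat.cast_le.1 h3.2⟩)
    · rw [Real.sqrt_le_one]
      simp only [div_pow, Real.sq_sqrt hT0.le]
      rw [← Finset.sum_div, hsum (fun i => (∑ k ∈ Finset.Icc (a i) (b i), x k) ^ 2), ← hTA,
        div_self hT0.ne']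
    · rw [sum_apply]
      simp only [smul_apply, intervalFunctional_Icc, smul_eq_mul]
      rw [Finset.sum_congr rfl fun i _ => div_mul_eq_mul_div _ _ _, ← Finset.sum_div,
        hsum (fun i => (∑ k ∈ Finset.Icc (a i) (b i), x k) *
          ∑ k ∈ Finset.Icc (a i) (b i), x k)]
      simp only [← sq]
      rw [← hTA, Real.div_sqrt]
      exact Real.lt_sqrt_of_sq_lt (by linarith)

/-- A point outside the closed hull would be separated from it by a weak-star continuous functional,
that is, by evaluation at some `x`; but the supremum over `setD` of the evaluations at `x` is
already `‖x‖`. -/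
theorem closedBall_subset_closure_convexHull :
    StrongDual.toWeakDual '' (Metric.closedBall (0 : StrongDual ℝ JamesSpace) 1) ⊆
      closure (convexHull ℝ (StrongDual.toWeakDual '' setD)) := by
  rintro _ ⟨g, hg, rfl⟩
  by_contra hc
  obtain ⟨l, s, h1, h2⟩ := geometric_hahn_banach_closed_point
    (convex_convexHull ℝ _).closure isClosed_closure hc
  obtain ⟨x, hx⟩ := LinearMap.dualEmbedding_surjective (topDualPairing ℝ JamesSpace) l
  have hlx : ∀ g : StrongDual ℝ JamesSpace, l (StrongDual.toWeakDual g) = g x := fun g => by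
    rw [← hx]; rfl
  rw [hlx] at h2
  have h3 : g x ≤ ‖x‖ := (le_abs_self _).trans
    (g.le_of_opNorm_le (mem_closedBall_zero_iff.1 hg) x |>.trans_eq (one_mul _))
  obtain ⟨d, hd, hdx⟩ := exists_mem_setD_lt x (h2.trans_le h3)
  have h4 := h1 _ (subset_closure (subset_convexHull ℝ _ (Set.mem_image_of_mem _ hd)))
  rw [hlx] at h4
  linarith

theorem isCompact_image_closedBall :
    IsCompact (StrongDual.toWeakDual '' (Metric.closedBall (0 : StrongDual ℝ JamesSpace) 1)) := by
  have h := WeakDual.isCompact_closedBall (𝕜 := ℝ) (0 : StrongDual ℝ JamesSpace) 1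
  convert h using 1
  ext g
  exact ⟨by rintro ⟨f, hf, rfl⟩; exact hf, fun h => ⟨_, h, rfl⟩⟩

theorem extDualBall_subset_setD₁ : extDualBall ⊆ setD₁ := by
  intro f hf
  have hB := isCompact_image_closedBall
  have hDB : closure (StrongDual.toWeakDual '' setD) ⊆
      StrongDual.toWeakDual '' (Metric.closedBall (0 : StrongDual ℝ JamesSpace) 1) :=
    closure_minimal (Set.image_mono setD_subset_closedBall) hB.isClosed
  have hext : StrongDual.toWeakDual f ∈ (StrongDual.toWeakDual ''
      (Metric.closedBall (0 : StrongDual ℝ JamesSpace) 1)).extremePoints ℝ := by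
    rw [← image_extremePoints]
    exact Set.mem_image_of_mem _ hf
  exact extremePoints_subset_of_isCompact hB
    ((convex_closedBall _ _).linear_image
      (StrongDual.toWeakDual (𝕜 := ℝ) (E := JamesSpace)).toLinearMap)
    (hB.of_isClosed_subset isClosed_closure hDB) hDB
    (closedBall_subset_closure_convexHull.trans
      (closure_mono (convexHull_mono subset_closure))) hext

theorem sum_jumps_sq_le_of_mem_extDualBall {f : StrongDual ℝ JamesSpace} (hf : f ∈ extDualBall)
    (N : ℕ) : ∑ n ∈ Finset.range N, jumps (coords f) n ^ 2 ≤ 1 :=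
  sum_jumps_sq_le_of_mem_setD₁ (extDualBall_subset_setD₁ hf) N

/-- A lower bound for an evaluation on the extreme points of the dual ball which belong to a
weak-star compact extreme subset is a lower bound on this subset. -/
theorem le_apply_of_isExtreme {Φ : Set (StrongDual ℝ JamesSpace)}
    (hΦ : IsExtreme ℝ (Metric.closedBall 0 1) Φ)
    (hcl : IsClosed (StrongDual.toWeakDual '' Φ)) {x : JamesSpace} {α : ℝ}
    (h : ∀ e ∈ extDualBall, e ∈ Φ → α ≤ e x) {g : StrongDual ℝ JamesSpace} (hg : g ∈ Φ) :
    α ≤ g x := by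
  have hcomp : IsCompact (StrongDual.toWeakDual '' Φ) :=
    isCompact_image_closedBall.of_isClosed_subset hcl (Set.image_mono hΦ.subset)
  have hcont : Continuous fun e : WeakDual ℝ JamesSpace => e x := WeakDual.eval_continuous x
  obtain ⟨m, ⟨m, hm, rfl⟩, hmin⟩ := hcomp.exists_isMinOn ⟨_, Set.mem_image_of_mem _ hg⟩
    hcont.continuousOn
  have hmin' : ∀ e ∈ Φ, m x ≤ e x := fun e he => hmin (Set.mem_image_of_mem _ he)
  -- The minimum of the evaluation on the compact set `Φ` is taken on a face of `Φ`. Krein-Milman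
  -- provides an extreme point of this face, which is then extreme in the whole ball.
  obtain ⟨e, he⟩ := (hcomp.inter_right (isClosed_le hcont (continuous_const (y := m x)))
    ).extremePoints_nonempty ⟨_, Set.mem_image_of_mem _ hm, le_refl (m x)⟩
  have hface : IsExtreme ℝ Φ (Φ ∩ {e | e x ≤ m x}) := by
    refine ⟨Set.inter_subset_left, fun y hy z hz w hw hwyz => ⟨hy, ?_⟩⟩
    obtain ⟨s, t, hs, ht, hst, rfl⟩ := hwyz
    have h1 := hw.2
    have h2 := hmin' y hy
    have h3 := hmin' z hz
    simp only [Set.mem_ofPred_eq, add_apply, smul_apply,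
      smul_eq_mul] at h1 ⊢
    have ht' : t = 1 - s := by linarith
    subst ht'
    nlinarith
  have hset : StrongDual.toWeakDual '' Φ ∩ {e : WeakDual ℝ JamesSpace | e x ≤ m x} =
      StrongDual.toWeakDual '' (Φ ∩ {e | e x ≤ m x}) := by
    ext w
    constructor
    · rintro ⟨⟨w, hw, rfl⟩, hwx⟩
      exact ⟨w, ⟨hw, hwx⟩, rfl⟩
    · rintro ⟨w, ⟨hw, hwx⟩, rfl⟩
      exact ⟨⟨w, hw, rfl⟩, hwx⟩
  rw [hset, ← image_extremePoints] at he
  obtain ⟨e, he, rfl⟩ := he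
  have he' : e ∈ extDualBall := (hΦ.trans hface).extremePoints_subset_extremePoints he
  exact (h e he' he.1.1).trans ((he.1.2 : e x ≤ m x).trans (hmin' g hg))

/-! ### Functionals of norm one -/

/-- Expand the square: both quadratic terms are at most `1`. This quantifies equality in
Cauchy-Schwarz, so that an almost norming `y` must have run sums close to the jumps of `c`. -/
theorem sum_jumps_sub_runSum_sq_le {c : ℕ → ℝ}
    (hc : ∀ N, ∑ n ∈ Finset.range N, jumps c n ^ 2 ≤ 1) {y : JamesSpace} (hy : ‖y‖ ≤ 1) (N : ℕ) :
    ∑ s ∈ Finset.range N, (jumps c s - runSum c y N s) ^ 2 ≤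
      2 - 2 * ∑ n ∈ Finset.range N, c n * y n := by
  have h1 := hc N
  have h2 := (sum_runSum_sq_le c y N).trans (pow_le_one₀ (norm_nonneg y) hy)
  rw [sum_mul_eq_sum_jumps, Finset.mul_sum]
  have : ∑ s ∈ Finset.range N, (jumps c s - runSum c y N s) ^ 2 =
      ∑ s ∈ Finset.range N, jumps c s ^ 2 + ∑ s ∈ Finset.range N, runSum c y N s ^ 2 -
        ∑ s ∈ Finset.range N, 2 * (jumps c s * runSum c y N s) := by
    rw [← Finset.sum_add_distrib, ← Finset.sum_sub_distrib]
    exact Finset.sum_congr rfl fun s _ => by ring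
  linarith

theorem le_sum_runSum_sq {c : ℕ → ℝ} (hc : ∀ N, ∑ n ∈ Finset.range N, jumps c n ^ 2 ≤ 1)
    (y : ℕ → ℝ) (N : ℕ) :
    2 * ∑ n ∈ Finset.range N, c n * y n - 1 ≤ ∑ s ∈ Finset.range N, runSum c y N s ^ 2 := by
  have h1 := hc N
  have h3 : ∑ s ∈ Finset.range N, 2 * (jumps c s * runSum c y N s) ≤
      ∑ s ∈ Finset.range N, jumps c s ^ 2 + ∑ s ∈ Finset.range N, runSum c y N s ^ 2 := by
    rw [← Finset.sum_add_distrib]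
    exact Finset.sum_le_sum fun s _ => by nlinarith [sq_nonneg (jumps c s - runSum c y N s)]
  rw [sum_mul_eq_sum_jumps, Finset.mul_sum]
  linarith

/-- All runs starting in `[u, v]` are merged into a single block. The map `m` that collapses `[u,
v]` to `u` is monotone, so the fibres of `m ∘ runStart c` are again intervals. -/
theorem sum_runSum_Icc_sq_le (c : ℕ → ℝ) (y : JamesSpace) (N u v : ℕ) :
    (∑ s ∈ Finset.Icc u v, runSum c y N s) ^ 2 +
      ∑ s ∈ Finset.range N \ Finset.Icc u v, runSum c y N s ^ 2 ≤ ‖y‖ ^ 2 := by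
  rcases lt_or_ge v u with huv | huv
  · simpa [Finset.Icc_eq_empty_of_lt huv] using sum_runSum_sq_le c y N
  let m : ℕ → ℕ := fun s => if s ∈ Finset.Icc u v then u else s
  have hm : Monotone m := fun s t hst => by
    simp only [m, Finset.mem_Icc]
    split_ifs <;> omega
  have h := sum_fiber_sq_le y (hm.comp (runStart_mono c))
    (insert u (Finset.range N \ Finset.Icc u v)) N
  rw [Finset.sum_insert (by simp [huv])] at h
  refine le_trans (le_of_eq ?_) h
  congr 1
  · congr 1
    simp only [runSum]
    rw [← Finset.sum_biUnion]
    · refine Finset.sum_congr ?_ fun _ _ => rfl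
      ext n
      simp only [Finset.mem_biUnion, Finset.mem_filter, Function.comp, m]
      constructor
      · rintro ⟨s, hs, hn, rfl⟩
        exact ⟨hn, if_pos hs⟩
      · rintro ⟨hn, h⟩
        refine ⟨runStart c n, ?_, hn, rfl⟩
        by_contra hc
        rw [if_neg hc] at h
        exact hc (by simp [h, huv])
    · intro i _ j _ hij
      refine Finset.disjoint_left.2 fun k h1 h2 => hij ?_
      exact (Finset.mem_filter.1 h1).2.symm.trans (Finset.mem_filter.1 h2).2
  · refine Finset.sum_congr rfl fun s hs => ?_
    have hs' := (Finset.mem_sdiff.1 hs).2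
    rw [runSum]
    congr 1
    refine Finset.sum_congr (Finset.filter_congr fun n _ => ?_) fun _ _ => rfl
    simp only [Function.comp, m]
    constructor
    · rintro rfl
      exact if_neg hs'
    · intro h
      split_ifs at h with h1
      · exact absurd (by simp [← h, huv]) hs'
      · exact h

theorem exists_norm_le_one_lt_sum {f : StrongDual ℝ JamesSpace} (hf : ‖f‖ = 1) {δ : ℝ}
    (hδ : 0 < δ) (M : ℕ) : ∃ (y : JamesSpace) (N : ℕ), M ≤ N ∧ ‖y‖ ≤ 1 ∧
      1 - δ < ∑ n ∈ Finset.range N, coords f n * y n := by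
  obtain ⟨y, hy, hfy⟩ := f.exists_lt_apply_of_lt_opNorm (r := 1 - δ) (by linarith)
  obtain ⟨z, hz, hfz⟩ : ∃ z : JamesSpace, ‖z‖ ≤ 1 ∧ 1 - δ < f z := by
    rw [Real.norm_eq_abs] at hfy
    rcases lt_abs.1 hfy with h | h
    · exact ⟨y, hy.le, h⟩
    · exact ⟨-y, by rw [norm_neg]; exact hy.le, by rwa [map_neg]⟩
  obtain ⟨N, hN, h⟩ := ((eventually_ge_atTop M).and
    ((tendsto_sum_coords f z).eventually (lt_mem_nhds hfz))).exists
  exact ⟨z, N, hN, hz, h⟩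

/-- The bound `‖f‖ ≤ √Q` forces `Q ≥ 1`, while `Q ≤ 1` by hypothesis. -/
theorem hasSum_jumps_sq {f : StrongDual ℝ JamesSpace}
    (hQ : ∀ N, ∑ n ∈ Finset.range N, jumps (coords f) n ^ 2 ≤ 1) (hf : ‖f‖ = 1) :
    HasSum (fun n => jumps (coords f) n ^ 2) 1 := by
  have hs : Summable fun n => jumps (coords f) n ^ 2 :=
    summable_of_sum_range_le (fun _ => sq_nonneg _) hQ
  have h1 : ∑' n, jumps (coords f) n ^ 2 ≤ 1 := Real.tsum_le_of_sum_range_le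
    (fun _ => sq_nonneg _) hQ
  have h2 := norm_le_sqrt (f := f) (B := ∑' n, jumps (coords f) n ^ 2)
    fun N => hs.sum_le_tsum _ fun _ _ => sq_nonneg _
  rw [hf, Real.one_le_sqrt] at h2
  rw [← le_antisymm h1 h2]
  exact hs.hasSum

/-- Take `y k` almost norming for `f`. The squares of its run sums add up to nearly `1`, and merging
the runs that start in `[u, v]` cannot push the total above `‖y k‖ ^ 2 ≤ 1`. So the merged square
exceeds the sum of the separate squares by at most `2 / (k + 1)`. The run sums converge to the
jumps, and the inequality passes to the limit. -/
theorem blockDominated_jumps {f : StrongDual ℝ JamesSpace}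
    (hQ : ∀ N, ∑ n ∈ Finset.range N, jumps (coords f) n ^ 2 ≤ 1) (hf : ‖f‖ = 1) :
    BlockDominated (jumps (coords f)) := by
  intro u v
  set c := coords f with hc
  have hδ : ∀ k : ℕ, (0 : ℝ) < 1 / ((k : ℝ) + 1) := fun k => Nat.one_div_pos_of_nat
  choose y N hN hy hlt using fun k : ℕ => exists_norm_le_one_lt_sum hf (hδ k) (v + 1)
  have hδ0 : Tendsto (fun k : ℕ => 2 * (1 / ((k : ℝ) + 1))) atTop (𝓝 0) := by
    simpa using (tendsto_one_div_add_atTop_nhds_zero_nat (𝕜 := ℝ)).const_mul 2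
  have hsub : ∀ k, Finset.Icc u v ⊆ Finset.range (N k) := fun k s hs => by
    have := (Finset.mem_Icc.1 hs).2
    have := hN k
    exact Finset.mem_range.2 (by omega)
  have hR : ∀ s ∈ Finset.Icc u v,
      Tendsto (fun k => runSum c (y k) (N k) s) atTop (𝓝 (jumps c s)) := by
    intro s hs
    rw [tendsto_iff_norm_sub_tendsto_zero]
    have h1 : Tendsto (fun k : ℕ => √(2 * (1 / ((k : ℝ) + 1)))) atTop (𝓝 0) := by
      simpa using hδ0.sqrt
    refine squeeze_zero (fun _ => norm_nonneg _) (fun k => ?_) h1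
    refine Real.le_sqrt_of_sq_le ?_
    have h2 := sum_jumps_sub_runSum_sq_le hQ (hy k) (N k)
    have h3 := Finset.single_le_sum
      (f := fun s => (jumps c s - runSum c (y k) (N k) s) ^ 2) (fun _ _ => sq_nonneg _) (hsub k hs)
    have h4 := hlt k
    rw [Real.norm_eq_abs, sq_abs]
    nlinarith
  have hlim : Tendsto (fun k => ∑ s ∈ Finset.Icc u v, runSum c (y k) (N k) s ^ 2 +
      2 * (1 / ((k : ℝ) + 1))) atTop (𝓝 (∑ s ∈ Finset.Icc u v, jumps c s ^ 2 + 0)) :=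
    (tendsto_finsetSum _ fun s hs => (hR s hs).pow 2).add hδ0
  rw [add_zero] at hlim
  refine le_of_tendsto_of_tendsto' ((tendsto_finsetSum _ hR).pow 2) hlim fun k => ?_
  have h1 := sum_runSum_Icc_sq_le c (y k) (N k) u v
  have h2 := le_sum_runSum_sq hQ (y k) (N k)
  have h3 := pow_le_one₀ (n := 2) (norm_nonneg (y k)) (hy k)
  have h4 := Finset.sum_sdiff (f := fun s => runSum c (y k) (N k) s ^ 2) (hsub k)
  have h5 := hlt k
  linarith

/-! ### Functionals attaining `1` at an euclidean vector -/

section Attaining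

variable {e : StrongDual ℝ JamesSpace} {z : JamesSpace}

theorem runSum_sq_le {y : ℕ → ℝ} (hy : BlockDominated y) (d : ℕ → ℝ) (N s : ℕ) :
    runSum d y N s ^ 2 ≤ ∑ n ∈ Finset.range N with runStart d n = s, y n ^ 2 := by
  refine hy.sq_sum_le _ fun a ha b hb k hak hkb => ?_
  simp only [Finset.mem_filter, Finset.mem_range] at *
  have h1 := runStart_mono d hak
  have h2 := runStart_mono d hkb
  omega

theorem tendsto_runSum (hQ : ∀ N, ∑ n ∈ Finset.range N, jumps (coords e) n ^ 2 ≤ 1)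
    (hz : BlockDominated z) (hz1 : ∀ N, ∑ n ∈ Finset.range N, z n ^ 2 ≤ 1) (hez : e z = 1) (s : ℕ) :
    Tendsto (fun N => runSum (coords e) z N s) atTop (𝓝 (jumps (coords e) s)) := by
  have hnz : ‖z‖ ≤ 1 := by
    have := norm_sq_le z fun n a b hd => hz.sum_blocks_le hz1 a b hd
    exact (sq_le_one_iff₀ (norm_nonneg _)).1 this
  have h0 : Tendsto (fun N => √(2 - 2 * ∑ n ∈ Finset.range N, coords e n * z n)) atTop (𝓝 0) := by
    have := (((tendsto_sum_coords e z).const_mul 2).const_sub 2).sqrt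
    simpa [hez] using this
  rw [tendsto_iff_norm_sub_tendsto_zero]
  refine squeeze_zero' (Eventually.of_forall fun _ => norm_nonneg _) ?_ h0
  filter_upwards [eventually_gt_atTop s] with N hN
  refine Real.le_sqrt_of_sq_le ?_
  rw [Real.norm_eq_abs, sq_abs, sub_sq_comm]
  exact (Finset.single_le_sum
    (f := fun s => (jumps (coords e) s - runSum (coords e) z N s) ^ 2) (fun _ _ => sq_nonneg _)
    (Finset.mem_range.2 hN)).trans (sum_jumps_sub_runSum_sq_le hQ hnz N)

/-- On each run of `e` the energy of `z` dominates the squared run sum. The total energy is at most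
`1`, while the squared run sums add up to nearly `1`; hence no single run can have a positive excess
in the limit. -/
theorem sum_run_sq_le (hQ : ∀ N, ∑ n ∈ Finset.range N, jumps (coords e) n ^ 2 ≤ 1)
    (hz : BlockDominated z) (hz1 : ∀ N, ∑ n ∈ Finset.range N, z n ^ 2 ≤ 1) (hez : e z = 1)
    (M s : ℕ) :
    ∑ n ∈ Finset.range M with runStart (coords e) n = s, z n ^ 2 ≤ jumps (coords e) s ^ 2 := by
  set d := coords e with hd
  have hlim : Tendsto (fun N => runSum d z N s ^ 2 + (2 - 2 * ∑ n ∈ Finset.range N, d n * z n))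
      atTop (𝓝 (jumps d s ^ 2)) := by
    have := ((tendsto_runSum hQ hz hz1 hez s).pow 2).add
      (((tendsto_sum_coords e z).const_mul 2).const_sub 2)
    simpa [hez] using this
  refine ge_of_tendsto hlim ?_
  filter_upwards [eventually_gt_atTop s, eventually_ge_atTop M] with N hN hMN
  have h1 := le_sum_runSum_sq hQ z N
  have h2 : ∑ k ∈ Finset.range N, ∑ n ∈ Finset.range N with runStart d n = k, z n ^ 2 ≤ 1 := by
    rw [Finset.sum_fiberwise_of_maps_to fun n hn => Finset.mem_range.2
      ((runStart_le d n).trans_lt (Finset.mem_range.1 hn))]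
    exact hz1 N
  have h3 := Finset.single_le_sum
    (f := fun k => ∑ n ∈ Finset.range N with runStart d n = k, z n ^ 2 - runSum d z N k ^ 2)
    (fun k _ => sub_nonneg.2 (runSum_sq_le hz d N k)) (Finset.mem_range.2 hN)
  rw [Finset.sum_sub_distrib] at h3
  have h4 : ∑ n ∈ Finset.range M with runStart d n = s, z n ^ 2 ≤
      ∑ n ∈ Finset.range N with runStart d n = s, z n ^ 2 :=
    Finset.sum_le_sum_of_subset_of_nonneg
      (Finset.filter_subset_filter _ (Finset.range_mono hMN)) fun _ _ _ => sq_nonneg _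
  linarith

/-- Write `d = coords e`. As `z` vanishes on the run before `m`, removing the entry `z m` leaves an
interval with sum tending to `d t - z m` and energy at most `d t ^ 2 - z m ^ 2`. Block domination on
the remainder gives `(d t - z m) ^ 2 ≤ d t ^ 2 - z m ^ 2`. -/
theorem sq_le_jumps_mul (hQ : ∀ N, ∑ n ∈ Finset.range N, jumps (coords e) n ^ 2 ≤ 1)
    (hz : BlockDominated z) (hz1 : ∀ N, ∑ n ∈ Finset.range N, z n ^ 2 ≤ 1) (hez : e z = 1)
    {m t : ℕ} (hm : runStart (coords e) m = t) (h0 : ∀ k, t ≤ k → k < m → z k = 0) :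
    z m ^ 2 ≤ jumps (coords e) t * z m := by
  set d := coords e with hd
  have hlim : Tendsto (fun N => z m ^ 2 + (runSum d z N t - z m) ^ 2) atTop
      (𝓝 (z m ^ 2 + (jumps d t - z m) ^ 2)) :=
    (((tendsto_runSum hQ hz hz1 hez t).sub_const _).pow 2).const_add _
  have key : z m ^ 2 + (jumps d t - z m) ^ 2 ≤ jumps d t ^ 2 := by
    refine le_of_tendsto hlim ?_
    filter_upwards [eventually_gt_atTop m] with N hN
    refine le_trans ?_ (sum_run_sq_le hQ hz hz1 hez N t)
    have hsplit : ∀ g : ℕ → ℝ, (∀ k, t ≤ k → k < m → g k = 0) →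
        ∑ n ∈ Finset.range N with runStart d n = t, g n =
          g m + ∑ n ∈ Finset.range N with runStart d n = t ∧ m < n, g n := by
      intro g hg
      rw [← Finset.sum_filter_add_sum_filter_not _ (fun n => m < n), add_comm, Finset.filter_filter,
        Finset.filter_filter]
      congr 1
      refine Finset.sum_eq_single m ?_ ?_
      · intro k hk hkm
        simp only [Finset.mem_filter, Finset.mem_range] at hk
        have := runStart_le d k
        exact hg k (by omega) (by omega)
      · intro h
        simp [hN, hm] at h
    rw [hsplit (fun n => z n ^ 2) fun k h1 h2 => by simp [h0 k h1 h2], runSum, hsplit _ h0,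
      add_sub_cancel_left]
    refine add_le_add_right (hz.sq_sum_le _ fun a ha b hb k hak hkb => ?_) _
    simp only [Finset.mem_filter, Finset.mem_range] at *
    have h1 := runStart_mono d hak
    have h2 := runStart_mono d hkb
    omega
  nlinarith

end Attaining

/-! ### Vectors at which a functional attains its norm -/

/-- The sequence `jumps c`, with the value of the run of `c` containing `n` moved to `n`. -/
def moved (c : ℕ → ℝ) (n : ℕ) : ℕ → ℝ :=
  jumps c + Pi.single n (c n) - Pi.single (runStart c n) (c n)

theorem moved_of_runStart_eq {c : ℕ → ℝ} {n : ℕ} (h : runStart c n = n) : moved c n = jumps c := by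
  rw [moved, h, add_sub_cancel_right]

theorem jumps_eq_zero_of_between {c : ℕ → ℝ} {k n : ℕ} (h1 : runStart c n < k) (h2 : k ≤ n) :
    jumps c k = 0 := by
  rw [jumps, if_neg]
  rw [runStart_eq_of_between h1.le h2]
  exact h1.ne

theorem moved_self (c : ℕ → ℝ) (n : ℕ) : moved c n n = c n := by
  by_cases h : runStart c n = n
  · rw [moved_of_runStart_eq h, jumps, if_pos h]
  · simp [moved, jumps_eq_zero_of_between (lt_of_le_of_ne (runStart_le c n) h) le_rfl,
      Pi.single_eq_of_ne (Ne.symm h)]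

theorem moved_sq (c : ℕ → ℝ) (n k : ℕ) : moved c n k ^ 2 =
    jumps c k ^ 2 + (Pi.single n (c n ^ 2) : ℕ → ℝ) k -
      (Pi.single (runStart c n) (c n ^ 2) : ℕ → ℝ) k := by
  by_cases h : runStart c n = n
  · rw [moved_of_runStart_eq h, h, add_sub_cancel_right]
  · rcases eq_or_ne k n with rfl | hk
    · rw [moved_self, jumps_eq_zero_of_between (lt_of_le_of_ne (runStart_le c k) h) le_rfl]
      simp [Pi.single_eq_of_ne (Ne.symm h)]
    · rcases eq_or_ne k (runStart c n) with rfl | hk'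
      · simp [moved, hk, jumps_runStart]
      · simp [moved, hk, hk']

theorem mul_moved (c : ℕ → ℝ) (n k : ℕ) : c k * moved c n k = moved c n k ^ 2 := by
  rcases eq_or_ne k n with rfl | hk
  · rw [moved_self, sq]
  · rcases eq_or_ne k (runStart c n) with rfl | hk'
    · simp [moved, hk, jumps_runStart]
    · by_cases h : runStart c k = k <;> simp [moved, hk, hk', jumps, h, sq]

theorem sum_moved (c : ℕ → ℝ) (n : ℕ) (A : Finset ℕ) : ∑ k ∈ A, moved c n k =
    ∑ k ∈ A, jumps c k + (if n ∈ A then c n else 0) - if runStart c n ∈ A then c n else 0 := by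
  simp only [moved, Pi.add_apply, Pi.sub_apply, Finset.sum_sub_distrib, Finset.sum_add_distrib,
    Finset.sum_pi_single']

theorem sum_moved_sq (c : ℕ → ℝ) (n : ℕ) (A : Finset ℕ) : ∑ k ∈ A, moved c n k ^ 2 =
    ∑ k ∈ A, jumps c k ^ 2 + (if n ∈ A then c n ^ 2 else 0) -
      if runStart c n ∈ A then c n ^ 2 else 0 := by
  simp only [moved_sq, Finset.sum_sub_distrib, Finset.sum_add_distrib, Finset.sum_pi_single']

theorem sum_Ico_jumps {c : ℕ → ℝ} {n w : ℕ} (h1 : runStart c n < w) (h2 : w ≤ n + 1) :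
    ∑ k ∈ Finset.Ico (runStart c n) w, jumps c k = c n ∧
      ∑ k ∈ Finset.Ico (runStart c n) w, jumps c k ^ 2 = c n ^ 2 := by
  have h0 : ∀ k ∈ Finset.Ico (runStart c n) w, k ≠ runStart c n → jumps c k = 0 := by
    intro k hk hne
    have := Finset.mem_Ico.1 hk
    exact jumps_eq_zero_of_between (n := n) (by omega) (by omega)
  have hmem : runStart c n ∈ Finset.Ico (runStart c n) w := Finset.left_mem_Ico.2 h1
  rw [Finset.sum_eq_single_of_mem _ hmem h0, Finset.sum_eq_single_of_mem _ hmem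
    fun k hk hne => by rw [h0 k hk hne]; simp, jumps_runStart]
  exact ⟨rfl, rfl⟩

theorem BlockDominated.moved {c : ℕ → ℝ} (hc : BlockDominated (jumps c)) (n : ℕ) :
    BlockDominated (moved c n) := by
  have hI : ∀ a b, (∑ k ∈ Finset.Ico a b, jumps c k) ^ 2 ≤ ∑ k ∈ Finset.Ico a b, jumps c k ^ 2 :=
    fun a b => hc.sq_sum_le _ fun p hp q hq k h1 h2 => by
      simp only [Finset.mem_Ico] at *; omega
  intro u v
  have hle := runStart_le c n
  have hIcc : Finset.Icc u v = Finset.Ico u (v + 1) := by ext k; simp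
  rw [hIcc, sum_moved, sum_moved_sq]
  by_cases h1 : n ∈ Finset.Ico u (v + 1) <;> by_cases h2 : runStart c n ∈ Finset.Ico u (v + 1)
  · simpa [h1, h2] using hI u (v + 1)
  -- The interval meets the run of `n` after its start. Extending it left to the start of the run
  -- exchanges the moved value for the original jump.
  · rw [if_pos h1, if_pos h1, if_neg h2, if_neg h2, sub_zero, sub_zero]
    simp only [Finset.mem_Ico] at h1 h2
    have h3 := sum_Ico_jumps (c := c) (n := n) (w := u) (by omega) (by omega)
    have h4 := hI (runStart c n) (v + 1)
    rw [← Finset.sum_Ico_consecutive _ (show runStart c n ≤ u by omega) (show u ≤ v + 1 by omega),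
      ← Finset.sum_Ico_consecutive _ (show runStart c n ≤ u by omega) (show u ≤ v + 1 by omega),
      h3.1, h3.2] at h4
    linarith
  -- The interval ends inside the run before `n`, so `moved c n` vanishes from the start of the run
  -- on and only the part before it counts.
  · rw [if_neg h1, if_neg h1, if_pos h2, if_pos h2, add_zero, add_zero]
    simp only [Finset.mem_Ico] at h1 h2
    have h3 := sum_Ico_jumps (c := c) (n := n) (w := v + 1) (by omega) (by omega)
    rw [← Finset.sum_Ico_consecutive _ h2.1 h2.2.le, ← Finset.sum_Ico_consecutive _ h2.1 h2.2.le,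
      h3.1, h3.2, add_sub_cancel_right, add_sub_cancel_right]
    exact hI _ _
  · simpa [h1, h2] using hI u (v + 1)

theorem exists_moved {f : StrongDual ℝ JamesSpace}
    (hsum : HasSum (fun n => jumps (coords f) n ^ 2) 1)
    (hbd : BlockDominated (jumps (coords f))) (n : ℕ) :
    ∃ z : JamesSpace, (z : ℕ → ℝ) = moved (coords f) n ∧ ‖z‖ ≤ 1 ∧ f z = 1 ∧
      ∀ N, ∑ k ∈ Finset.range N, z k ^ 2 ≤ 1 := by
  set c := coords f with hc
  have heq : ∀ N, n < N →
      ∑ k ∈ Finset.range N, moved c n k ^ 2 = ∑ k ∈ Finset.range N, jumps c k ^ 2 := by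
    intro N hN
    rw [sum_moved_sq, if_pos (Finset.mem_range.2 hN),
      if_pos (Finset.mem_range.2 ((runStart_le c n).trans_lt hN)), add_sub_cancel_right]
  have hle : ∀ N, ∑ k ∈ Finset.range N, moved c n k ^ 2 ≤ 1 := fun N => by
    refine (Finset.sum_le_sum_of_subset_of_nonneg (Finset.range_mono (le_max_left N (n + 1)))
      fun _ _ _ => sq_nonneg _).trans ?_
    rw [heq _ (by omega)]
    exact sum_le_hasSum _ (fun _ _ => sq_nonneg _) hsum
  obtain ⟨z, hz, hnorm⟩ := (hbd.moved n).exists_jamesSpace hle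
  refine ⟨z, hz, (sq_le_one_iff₀ (norm_nonneg _)).1 hnorm, ?_, by rwa [hz]⟩
  refine tendsto_nhds_unique (tendsto_sum_coords f z) (hsum.tendsto_sum_nat.congr' ?_)
  filter_upwards [eventually_gt_atTop n] with N hN
  rw [← heq N hN, hz]
  exact Finset.sum_congr rfl fun k _ => (mul_moved c n k).symm

/-! ### A sufficient condition for extremality -/

/-- The points at which `c` does not vanish form an interval. -/
def NoGap (c : ℕ → ℝ) : Prop := ∀ i j k, i < j → j < k → c i ≠ 0 → c k ≠ 0 → c j ≠ 0

/-- Once the earlier coordinates are fixed, the `n`-th one is bounded on one side over all extreme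
`e` that share the norming vectors of `f`. A one-sided bound is enough to cut out a face. The
vectors `moved (coords f) n` test `e` exactly at position `n`. -/
theorem exists_mul_coords_le {f : StrongDual ℝ JamesSpace}
    (hsum : HasSum (fun n => jumps (coords f) n ^ 2) 1)
    (hbd : BlockDominated (jumps (coords f))) (hgap : NoGap (coords f)) (n : ℕ) :
    ∃ σ : ℝ, σ ≠ 0 ∧ ∀ e ∈ extDualBall, (∀ z : JamesSpace, ‖z‖ ≤ 1 → f z = 1 → e z = 1) →
      (∀ k < n, coords e k = coords f k) → σ * coords f n ≤ σ * coords e n := by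
  set c := coords f with hc
  have hjump0 : ∀ k, c k = 0 → jumps c k = 0 := fun k hk => by rw [jumps, hk, ite_self]
  by_cases hn : c n = 0
  · by_cases hlead : ∃ i < n, c i ≠ 0
    · obtain ⟨i, hin, hi⟩ := hlead
      have htail : ∀ k, n ≤ k → c k = 0 := fun k hk => by
        rcases hk.eq_or_lt with rfl | hk
        · exact hn
        · by_contra h
          exact hgap i n k hin hk hi h hn
      obtain ⟨m, rfl⟩ : ∃ m, n = m + 1 := ⟨n - 1, by omega⟩
      -- Either `e` continues its run with the value `c m`, or a new run starts at `m + 1`, where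
      -- `jumps c` has no mass left, so that the value is `0`. The sign of `c m` makes both cases
      -- nonnegative; if `c m = 0`, both values vanish.
      refine ⟨if c m = 0 then 1 else c m, by split_ifs <;> simp_all, fun e he hez hek => ?_⟩
      have hQ := sum_jumps_sq_le_of_mem_extDualBall he
      have hor : coords e (m + 1) = 0 ∨ coords e (m + 1) = c m := by
        by_cases ht : coords e (m + 1) = coords e m
        · exact Or.inr (ht.trans (hek m m.lt_succ_self))
        · have ht' : runStart (coords e) (m + 1) = m + 1 := by rw [runStart, if_neg ht]
          -- Index `0` starts its own run, so this is the unmoved vector `jumps c`.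
          obtain ⟨z, hz, hz1, hfz, hzN⟩ := exists_moved hsum hbd 0
          rw [moved_of_runStart_eq rfl] at hz
          have h1 := tendsto_runSum hQ (by rwa [hz]) hzN (hez z hz1 hfz) (m + 1)
          rw [jumps, if_pos ht'] at h1
          refine Or.inl (tendsto_nhds_unique h1 (tendsto_const_nhds.congr fun N => ?_))
          refine (Finset.sum_eq_zero fun k hk => ?_).symm
          rw [hz]
          refine hjump0 k (htail k ?_)
          rw [← (Finset.mem_filter.1 hk).2]
          exact runStart_le _ k
      rw [hn, mul_zero]
      rcases hor with h | h
      · rw [h, mul_zero]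
      · rw [h]
        split_ifs with h0
        · rw [h0, mul_zero]
        · exact mul_self_nonneg _
    · push Not at hlead
      have hex : ∃ m, c m ≠ 0 := by
        by_contra! h
        have : (fun k => jumps c k ^ 2) = fun _ => 0 := by
          funext k
          rw [hjump0 k (h k)]
          simp
        rw [this] at hsum
        exact zero_ne_one (hasSum_zero.unique hsum)
      classical
      obtain ⟨m, hm, hmin⟩ : ∃ m, c m ≠ 0 ∧ ∀ k < m, c k = 0 :=
        ⟨Nat.find hex, Nat.find_spec hex, fun k hk => not_not.1 (Nat.find_min hex hk)⟩
      have hnm : n < m := by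
        by_contra h
        rcases (not_lt.1 h).eq_or_lt with h | h
        · exact hm (h ▸ hn)
        · exact hm (hlead m h)
      -- Before the first nonzero coordinate `c m`, a run of `e` that starts at `n` either reaches
      -- `m`, and then has the sign of `c m`, or carries no mass of `jumps c`, and then has value
      -- `0`.
      refine ⟨c m, hm, fun e he hez hek => ?_⟩
      have hQ := sum_jumps_sq_le_of_mem_extDualBall he
      rw [hn, mul_zero]
      by_cases ht : runStart (coords e) n = n
      · obtain ⟨z, hz, hz1, hfz, hzN⟩ := exists_moved hsum hbd 0
        rw [moved_of_runStart_eq rfl] at hz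
        have hz0 : ∀ k < m, z k = 0 := fun k hk => by rw [hz]; exact hjump0 k (hmin k hk)
        by_cases hrm : runStart (coords e) m = n
        · have h1 := sq_le_jumps_mul hQ (by rwa [hz]) hzN (hez z hz1 hfz) hrm
            fun k _ hk => hz0 k hk
          have hzm : z m = c m := by
            rw [hz]
            obtain ⟨p, rfl⟩ : ∃ p, m = p + 1 := ⟨m - 1, by omega⟩
            rw [← hc, jumps_succ, hmin p p.lt_succ_self, if_neg hm]
          rw [hzm, jumps, if_pos ht] at h1
          nlinarith [sq_nonneg (c m)]
        · have h1 := tendsto_runSum hQ (by rwa [hz]) hzN (hez z hz1 hfz) n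
          rw [jumps, if_pos ht] at h1
          have h2 : coords e n = 0 := by
            refine tendsto_nhds_unique h1 (tendsto_const_nhds.congr fun N => ?_)
            refine (Finset.sum_eq_zero fun k hk => hz0 k ?_).symm
            by_contra hkm
            have h3 := runStart_mono (coords e) (not_lt.1 hkm)
            have h4 := runStart_mono (coords e) hnm.le
            rw [(Finset.mem_filter.1 hk).2] at h3
            rw [ht] at h4
            exact hrm (le_antisymm h3 h4)
          rw [h2, mul_zero]
      · obtain ⟨p, rfl⟩ : ∃ p, n = p + 1 := by
          cases n with
          | zero => exact absurd rfl ht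
          | succ p => exact ⟨p, rfl⟩
        have h1 : coords e (p + 1) = coords e p := by
          by_contra h
          exact ht (by rw [runStart, if_neg h])
        rw [h1, hek p p.lt_succ_self, hlead p p.lt_succ_self, mul_zero]
  · refine ⟨c n, hn, fun e he hez hek => ?_⟩
    have hQ := sum_jumps_sq_le_of_mem_extDualBall he
    obtain ⟨z, hz, hz1, hfz, hzN⟩ := exists_moved hsum hbd n
    have hzb : BlockDominated z := by rw [hz]; exact hbd.moved n
    by_cases ht : runStart (coords e) n = n
    · have h1 := sq_le_jumps_mul hQ hzb hzN (hez z hz1 hfz) ht (fun k h1 h2 => by omega)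
      rw [hz, ← hc, moved_self, jumps, if_pos ht] at h1
      linarith
    · obtain ⟨p, rfl⟩ : ∃ p, n = p + 1 := by
        cases n with
        | zero => exact absurd rfl ht
        | succ p => exact ⟨p, rfl⟩
      have h1 : coords e (p + 1) = coords e p := by
        by_contra h
        exact ht (by rw [runStart, if_neg h])
      rw [h1, hek p p.lt_succ_self]
      by_cases hcp : c (p + 1) = c p
      · rw [hcp]
      -- Here `e` continues a run across a jump of `c`. That run would carry both the energy `z t ^
      -- 2`, which already exhausts its bound, and the nonzero energy `c (p + 1) ^ 2`.
      · exfalso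
        have hrc : runStart c (p + 1) = p + 1 := by rw [runStart, if_neg hcp]
        rw [← hc, moved_of_runStart_eq hrc] at hz
        set t := runStart (coords e) (p + 1) with ht'
        have htp : t < p + 1 := lt_of_le_of_ne (runStart_le _ _) ht
        have h2 := sum_run_sq_le hQ hzb hzN (hez z hz1 hfz) (p + 2) t
        have h3 : ∑ k ∈ {t, p + 1}, z k ^ 2 ≤
            ∑ k ∈ Finset.range (p + 2) with runStart (coords e) k = t, z k ^ 2 := by
          refine Finset.sum_le_sum_of_subset_of_nonneg (fun k hk => ?_) fun _ _ _ => sq_nonneg _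
          rw [Finset.mem_filter, Finset.mem_range]
          rcases Finset.mem_insert.1 hk with rfl | hk
          · exact ⟨by omega, runStart_runStart _ _⟩
          · rw [Finset.mem_singleton.1 hk]
            exact ⟨by omega, rfl⟩
        rw [Finset.sum_pair htp.ne] at h3
        rw [jumps_congr (c := coords e) (d := c) fun k hk => hek k (by omega)] at h2
        have h5 : z t = jumps c t := by rw [hz]
        have h6 : z (p + 1) = c (p + 1) := by rw [hz, jumps, if_pos hrc]
        rw [h5, h6] at h3
        have h4 : 0 < c (p + 1) ^ 2 := by positivity
        linarith

/-- The sets `Φ n` of functionals in the ball that share the norming vectors and the first `n`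
coordinates of `f` form a decreasing sequence of faces. Indeed `Φ (n + 1)` is the part of `Φ n`
where evaluation at `σ n • unitVec n` takes its minimum. It suffices to bound that evaluation at
extreme points of the ball, which is where `Q ≤ 1` is available. Only `f` lies in all `Φ n`. -/
theorem mem_extDualBall {f : StrongDual ℝ JamesSpace}
    (hsum : HasSum (fun n => jumps (coords f) n ^ 2) 1)
    (hbd : BlockDominated (jumps (coords f))) (hgap : NoGap (coords f)) : f ∈ extDualBall := by
  choose σ hσ0 hσ using exists_mul_coords_le hsum hbd hgap
  let Φ : ℕ → Set (StrongDual ℝ JamesSpace) := fun n =>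
    {g | g ∈ Metric.closedBall (0 : StrongDual ℝ JamesSpace) 1 ∧
      (∀ z : JamesSpace, ‖z‖ ≤ 1 → f z = 1 → g z = 1) ∧ ∀ k < n, coords g k = coords f k}
  have hfB : f ∈ Metric.closedBall (0 : StrongDual ℝ JamesSpace) 1 := by
    rw [mem_closedBall_zero_iff]
    simpa using norm_le_sqrt (f := f) (B := 1)
      fun N => sum_le_hasSum _ (fun _ _ => sq_nonneg _) hsum
  have hfΦ : ∀ n, f ∈ Φ n := fun n => ⟨hfB, fun _ _ h => h, fun _ _ => rfl⟩
  have hclosed : ∀ n, IsClosed (StrongDual.toWeakDual '' Φ n) := by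
    intro n
    have h : StrongDual.toWeakDual '' Φ n =
        StrongDual.toWeakDual '' Metric.closedBall (0 : StrongDual ℝ JamesSpace) 1 ∩
          ((⋂ z : {z : JamesSpace // ‖z‖ ≤ 1 ∧ f z = 1}, {g : WeakDual ℝ JamesSpace | g z.1 = 1}) ∩
            ⋂ k : {k // k < n}, {g : WeakDual ℝ JamesSpace | g (unitVec k.1) = coords f k.1}) := by
      ext g
      constructor
      · rintro ⟨g, ⟨h1, h2, h3⟩, rfl⟩
        exact ⟨⟨g, h1, rfl⟩, Set.mem_iInter.2 fun z => h2 z.1 z.2.1 z.2.2,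
          Set.mem_iInter.2 fun k => h3 k.1 k.2⟩
      · rintro ⟨⟨g, h1, rfl⟩, h2, h3⟩
        exact ⟨g, ⟨h1, fun z hz hfz => Set.mem_iInter.1 h2 ⟨z, hz, hfz⟩,
          fun k hk => Set.mem_iInter.1 h3 ⟨k, hk⟩⟩, rfl⟩
    rw [h]
    refine isCompact_image_closedBall.isClosed.inter ((isClosed_iInter fun z => ?_).inter
      (isClosed_iInter fun k => ?_))
    · exact isClosed_eq (WeakDual.eval_continuous _) continuous_const
    · exact isClosed_eq (WeakDual.eval_continuous _) continuous_const
  have hext : ∀ n, IsExtreme ℝ (Metric.closedBall 0 1) (Φ n) := by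
    intro n
    induction n with
    | zero =>
      refine ⟨fun g hg => hg.1, fun g₁ hg₁ g₂ hg₂ g hg hseg => ⟨hg₁, fun z hz hfz => ?_,
        fun k hk => absurd hk (Nat.not_lt_zero k)⟩⟩
      obtain ⟨a, b, ha, hb, hab, rfl⟩ := hseg
      have h0 := hg.2.1 z hz hfz
      have hle : ∀ g ∈ Metric.closedBall (0 : StrongDual ℝ JamesSpace) 1, g z ≤ 1 := fun g hg =>
        (le_abs_self _).trans ((g.le_opNorm z).trans
          (mul_le_one₀ (mem_closedBall_zero_iff.1 hg) (norm_nonneg z) hz))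
      have h1 := hle g₁ hg₁
      have h2 := hle g₂ hg₂
      simp only [add_apply, smul_apply, smul_eq_mul] at h0
      refine le_antisymm h1 ?_
      by_contra h3
      nlinarith
    | succ n ih =>
      refine ih.trans ⟨fun g hg => ⟨hg.1, hg.2.1, fun k hk => hg.2.2 k (by omega)⟩,
        fun g₁ hg₁ g₂ hg₂ g hg hseg => ⟨hg₁.1, hg₁.2.1, fun k hk => ?_⟩⟩
      rcases (Nat.lt_succ_iff.1 hk).lt_or_eq with hk | rfl
      · exact hg₁.2.2 k hk
      have hle : ∀ g ∈ Φ k, σ k * coords f k ≤ σ k * coords g k := by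
        intro g hg
        have := le_apply_of_isExtreme ih (hclosed k) (x := σ k • unitVec k)
          (α := σ k * coords f k) (fun e he heΦ => by
            rw [map_smul, smul_eq_mul]
            exact hσ k e he heΦ.2.1 heΦ.2.2) hg
        rwa [map_smul, smul_eq_mul] at this
      obtain ⟨a, b, ha, hb, hab, rfl⟩ := hseg
      have h0 := hg.2.2 k k.lt_succ_self
      have h1 := hle g₁ hg₁
      have h2 := hle g₂ hg₂
      simp only [coords_add, coords_smul, Pi.add_apply, Pi.smul_apply, smul_eq_mul] at h0
      refine mul_left_cancel₀ (hσ0 k) (le_antisymm ?_ h1)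
      by_contra h3
      have h4 : σ k * coords f k = a * (σ k * coords g₁ k) + b * (σ k * coords g₂ k) := by
        rw [← h0]; ring
      have h5 : σ k * coords f k = a * (σ k * coords f k) + b * (σ k * coords f k) := by
        rw [← add_mul, hab, one_mul]
      have h6 := mul_lt_mul_of_pos_left (not_le.1 h3) ha
      have h7 := mul_le_mul_of_nonneg_left h2 hb.le
      linarith
  refine mem_extremePoints_iff_left.2 ⟨hfB, fun g₁ hg₁ g₂ hg₂ hseg => coords_injective ?_⟩
  funext n
  exact ((hext (n + 1)).left_mem_of_mem_openSegment hg₁ hg₂ (hfΦ (n + 1)) hseg).2.2 n n.lt_succ_self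

/-! ### Functionals with prescribed coordinates -/

/-- The partial sums of `∑ c n eₙ*` stay in the ball of radius `√B`, which is weak-star compact.
Each coordinate is eventually constant along them, so a limit along an ultrafilter has the
coordinates `c`. -/
theorem exists_coords_eq {c : ℕ → ℝ} {B : ℝ}
    (hB : ∀ N, ∑ n ∈ Finset.range N, jumps c n ^ 2 ≤ B) :
    ∃ f : StrongDual ℝ JamesSpace, coords f = c := by
  let g : ℕ → StrongDual ℝ JamesSpace := fun N => ∑ n ∈ Finset.range N, c n • coordFunctional n
  have hg : ∀ N, g N ∈ Metric.closedBall (0 : StrongDual ℝ JamesSpace) √B := fun N => by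
    rw [mem_closedBall_zero_iff]
    refine (g N).opNorm_le_bound (Real.sqrt_nonneg B) fun x => ?_
    have h := abs_sum_mul_le hB x N
    have h2 : g N x = ∑ n ∈ Finset.range N, c n * x n := by
      rw [sum_apply]
      exact Finset.sum_congr rfl fun n _ => by
        rw [smul_apply, coordFunctional_apply, smul_eq_mul]
    rwa [h2]
  have hK := WeakDual.isCompact_closedBall (𝕜 := ℝ) (0 : StrongDual ℝ JamesSpace) √B
  obtain ⟨f, -, hf⟩ := hK.ultrafilter_le_nhds
    ((Filter.hyperfilter ℕ).map fun N => StrongDual.toWeakDual (g N))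
    (by
      rw [Ultrafilter.coe_map, le_principal_iff]
      exact Filter.mem_map.2 (Filter.univ_mem' hg))
  refine ⟨WeakDual.toStrongDual f, funext fun n => ?_⟩
  have h1 : Tendsto (fun N => StrongDual.toWeakDual (g N) (unitVec n)) (Filter.hyperfilter ℕ)
      (𝓝 (f (unitVec n))) := ((WeakDual.eval_continuous (unitVec n)).tendsto f).comp hf
  refine tendsto_nhds_unique h1 (tendsto_const_nhds.congr' ?_)
  have h2 : ∀ᶠ N in atTop, c n = StrongDual.toWeakDual (g N) (unitVec n) := by
    filter_upwards [eventually_gt_atTop n] with N hN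
    rw [StrongDual.toWeakDual_apply, sum_apply, Finset.sum_eq_single_of_mem n
      (Finset.mem_range.2 hN)]
    · rw [smul_apply, coordFunctional_apply, unitVec_coe]
      simp
    · intro k _ hk
      rw [smul_apply, coordFunctional_apply, unitVec_coe]
      simp [hk]
  exact Nat.hyperfilter_le_atTop h2

theorem smul_mem_extDualBall {f : StrongDual ℝ JamesSpace} {q : ℝ} (hq : 0 < q)
    (hsum : HasSum (fun n => jumps (coords f) n ^ 2) q)
    (hbd : BlockDominated (jumps (coords f))) (hgap : NoGap (coords f)) :
    (1 / √q) • f ∈ extDualBall := by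
  have hs : (1 / √q) ≠ 0 := by positivity
  refine mem_extDualBall ?_ ?_ ?_
  · have h := hsum.mul_left ((1 / √q) ^ 2)
    rw [div_pow, Real.sq_sqrt hq.le, one_pow, one_div_mul_cancel hq.ne'] at h
    simpa only [coords_smul, jumps_smul, Pi.smul_apply, smul_eq_mul, mul_pow, div_pow, one_pow,
      Real.sq_sqrt hq.le] using h
  · intro u v
    simp only [coords_smul, jumps_smul, Pi.smul_apply, smul_eq_mul, ← Finset.mul_sum, mul_pow]
    exact mul_le_mul_of_nonneg_left (hbd u v) (sq_nonneg _)
  · intro i j k hij hjk hi hk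
    simp only [coords_smul, Pi.smul_apply, smul_eq_mul, mul_ne_zero_iff] at *
    exact ⟨hs, hgap i j k hij hjk hi.2 hk.2⟩

/-! ### Lengthening an interval at both ends -/

/-- Here `r` and `l` bound the support of `x` in `[u, v]` on the left and on the right. For `r < l`
the difference of the two sides is affine in `s` and in `t` separately, as the terms `s ^ 2` and `t
^ 2` cancel. It is therefore enough to check the corners of the unit square, where it reduces to
block domination on `[r, l]` with one or both ends removed. -/
theorem BlockDominated.sq_add_ends_le {x : ℕ → ℝ} (hx : BlockDominated x) {u v r l : ℕ}
    {s t : ℝ} (hs0 : 0 ≤ s) (hs1 : s ≤ 1) (ht0 : 0 ≤ t) (ht1 : t ≤ 1)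
    (hur : u ≤ r) (hrv : r ≤ v) (hul : u ≤ l) (hlv : l ≤ v)
    (hr : ∀ k, u ≤ k → k < r → x k = 0) (hl : ∀ k, l < k → k ≤ v → x k = 0) :
    (∑ k ∈ Finset.Icc u v, x k - s * x r - t * x l) ^ 2 ≤
      ∑ k ∈ Finset.Icc u v, x k ^ 2 + (s * x r) ^ 2 + (t * x l) ^ 2 := by
  rcases lt_trichotomy r l with h | rfl | h
  · have hsub : ∀ g : ℕ → ℝ, (∀ k, x k = 0 → g k = 0) →
        ∑ k ∈ Finset.Icc u v, g k = g r + ∑ k ∈ Finset.Ioo r l, g k + g l := by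
      intro g hg
      have h1 : ∑ k ∈ Finset.Icc u v, g k = ∑ k ∈ Finset.Icc r l, g k := by
        refine (Finset.sum_subset (Finset.Icc_subset_Icc hur hlv) fun k h1 h2 => hg k ?_).symm
        simp only [Finset.mem_Icc, not_and_or, not_le] at h1 h2
        rcases h2 with h2 | h2
        · exact hr k h1.1 h2
        · exact hl k h2 h1.2
      rw [h1, ← Finset.Ico_insert_right h.le, Finset.sum_insert (by simp),
        ← Finset.Ioo_insert_left h, Finset.sum_insert (by simp)]
      ring
    have hoc : ∀ A : Finset ℕ, (∀ a ∈ A, ∀ b ∈ A, ∀ k, a ≤ k → k ≤ b → k ∈ A) →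
        (∑ k ∈ A, x k) ^ 2 ≤ ∑ k ∈ A, x k ^ 2 := fun A hA => hx.sq_sum_le A hA
    have h0 := hoc (Finset.Ioo r l) fun a ha b hb k h1 h2 => by
      simp only [Finset.mem_Ioo] at *; omega
    have h1 := hoc (Finset.Ico r l) fun a ha b hb k h1 h2 => by
      simp only [Finset.mem_Ico] at *; omega
    have h2 := hoc (Finset.Ioc r l) fun a ha b hb k h1 h2 => by
      simp only [Finset.mem_Ioc] at *; omega
    have h3 := hx u v
    rw [hsub x fun _ h => h, hsub (fun k => x k ^ 2) fun k h => by simp [h]] at h3 ⊢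
    rw [← Finset.Ioo_insert_left h, Finset.sum_insert (by simp), Finset.sum_insert (by simp)] at h1
    rw [← Finset.Ioo_insert_right h, Finset.sum_insert (by simp), Finset.sum_insert (by simp)] at h2
    generalize x r = a at *
    generalize x l = b at *
    generalize ∑ k ∈ Finset.Ioo r l, x k = S at *
    generalize ∑ k ∈ Finset.Ioo r l, x k ^ 2 = P at *
    have k0 := mul_nonneg (mul_nonneg (sub_nonneg.2 hs1) (sub_nonneg.2 ht1)) (sub_nonneg.2 h3)
    have k1 := mul_nonneg (mul_nonneg hs0 (sub_nonneg.2 ht1))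
      (show 0 ≤ b ^ 2 + P - (b + S) ^ 2 + 2 * a ^ 2 by nlinarith [sq_nonneg a])
    have k2 := mul_nonneg (mul_nonneg (sub_nonneg.2 hs1) ht0)
      (show 0 ≤ a ^ 2 + P - (a + S) ^ 2 + 2 * b ^ 2 by nlinarith [sq_nonneg b])
    have k3 := mul_nonneg (mul_nonneg hs0 ht0)
      (show 0 ≤ P - S ^ 2 + 2 * a ^ 2 + 2 * b ^ 2 by nlinarith [sq_nonneg a, sq_nonneg b])
    linear_combination k0 + k1 + k2 + k3
  · have h0 : ∀ k ∈ Finset.Icc u v, k ≠ r → x k = 0 := fun k hk hne => by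
      rw [Finset.mem_Icc] at hk
      rcases lt_or_gt_of_ne hne with h | h
      · exact hr k hk.1 h
      · exact hl k h hk.2
    have hmem : r ∈ Finset.Icc u v := Finset.mem_Icc.2 ⟨hur, hrv⟩
    rw [Finset.sum_eq_single_of_mem _ hmem h0, Finset.sum_eq_single_of_mem _ hmem
      fun k hk hne => by rw [h0 k hk hne]; simp]
    have h1 : 0 ≤ s * (1 - t) + t := by nlinarith
    nlinarith [mul_nonneg h1 (sq_nonneg (x r))]
  · have h0 : ∀ k ∈ Finset.Icc u v, x k = 0 := fun k hk => by
      rw [Finset.mem_Icc] at hk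
      rcases lt_or_ge k r with h1 | h1
      · exact hr k hk.1 h1
      · exact hl k (by omega) hk.2
    rw [Finset.sum_eq_zero h0, hr l hul h, hl r h hrv]
    have := Finset.sum_nonneg fun k (_ : k ∈ Finset.Icc u v) => sq_nonneg (x k)
    nlinarith

/-! ### Filling the gaps of a sequence -/

/-- The last nonzero value of `c` before `n`. -/
def lastVal (c : ℕ → ℝ) : ℕ → ℝ
  | 0 => 0
  | n + 1 => if c n = 0 then lastVal c n else c n

open Classical in
/-- The first nonzero value of `c` after `n`. -/
def nextVal (c : ℕ → ℝ) (n : ℕ) : ℝ :=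
  if h : ∃ k, n < k ∧ c k ≠ 0 then c (Nat.find h) else 0

/-- The size of the correction made in the gap of `c` containing `n`. -/
def gapVal (c : ℕ → ℝ) (n : ℕ) : ℝ := lastVal c n * |nextVal c n|

/-- A sequence supported in the gaps of `c`, with one value at the first point of a gap and the
opposite value at its other points. -/
def fill (c : ℕ → ℝ) : ℕ → ℝ
  | 0 => 0
  | n + 1 => if c (n + 1) = 0 then if c n = 0 then gapVal c (n + 1) else -gapVal c (n + 1) else 0

/-- The correction at the first points of the gaps. -/
def gapStart (c : ℕ → ℝ) : ℕ → ℝ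
  | 0 => 0
  | n + 1 => if c (n + 1) = 0 ∧ c n ≠ 0 then gapVal c (n + 1) else 0

/-- The sequence `gapStart c`, shifted by one. -/
def gapShift (c : ℕ → ℝ) : ℕ → ℝ
  | 0 => 0
  | n + 1 => gapStart c n

theorem lastVal_spec {c : ℕ → ℝ} {n : ℕ} (h : lastVal c n ≠ 0) :
    ∃ l < n, c l = lastVal c n ∧ ∀ k, l < k → k < n → c k = 0 := by
  induction n with
  | zero => exact absurd rfl h
  | succ n ih =>
    by_cases hn : c n = 0
    · rw [lastVal, if_pos hn] at h ⊢
      obtain ⟨l, h1, h2, h3⟩ := ih h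
      refine ⟨l, by omega, h2, fun k hk hk' => ?_⟩
      rcases (Nat.lt_succ_iff.1 hk').lt_or_eq with h4 | rfl
      · exact h3 k hk h4
      · exact hn
    · rw [lastVal, if_neg hn]
      exact ⟨n, by omega, rfl, fun k _ _ => by omega⟩

theorem lastVal_ne_zero {c : ℕ → ℝ} {l n : ℕ} (hl : l < n) (h : c l ≠ 0) : lastVal c n ≠ 0 := by
  induction n with
  | zero => omega
  | succ n ih =>
    by_cases hn : c n = 0
    · rw [lastVal, if_pos hn]
      refine ih (lt_of_le_of_ne (by omega) ?_)
      rintro rfl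
      exact h hn
    · rwa [lastVal, if_neg hn]

theorem nextVal_eq {c : ℕ → ℝ} {n r : ℕ} (hr : n < r) (h : c r ≠ 0)
    (h0 : ∀ k, n < k → k < r → c k = 0) : nextVal c n = c r := by
  classical
  have hex : ∃ k, n < k ∧ c k ≠ 0 := ⟨r, hr, h⟩
  have h1 : Nat.find hex = r := by
    rw [Nat.find_eq_iff]
    exact ⟨⟨hr, h⟩, fun k hk hk' => hk'.2 (h0 k hk'.1 hk)⟩
  rw [nextVal, dif_pos hex]
  convert congrArg c h1

theorem exists_next {c : ℕ → ℝ} {n : ℕ} (h : ∃ k, n < k ∧ c k ≠ 0) :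
    ∃ r, n < r ∧ c r ≠ 0 ∧ ∀ k, n < k → k < r → c k = 0 := by
  classical
  exact ⟨Nat.find h, (Nat.find_spec h).1, (Nat.find_spec h).2, fun k h1 h2 =>
    not_not.1 fun h3 => Nat.find_min h h2 ⟨h1, h3⟩⟩

theorem nextVal_spec {c : ℕ → ℝ} {n : ℕ} (h : nextVal c n ≠ 0) :
    ∃ r, n < r ∧ c r = nextVal c n ∧ ∀ k, n < k → k < r → c k = 0 := by
  have hex : ∃ k, n < k ∧ c k ≠ 0 := by
    by_contra hc
    rw [nextVal, dif_neg hc] at h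
    exact h rfl
  obtain ⟨r, h1, h2, h3⟩ := exists_next hex
  exact ⟨r, h1, (nextVal_eq h1 h2 h3).symm, h3⟩

theorem nextVal_ne_zero {c : ℕ → ℝ} {n k : ℕ} (hk : n < k) (h : c k ≠ 0) : nextVal c n ≠ 0 := by
  obtain ⟨r, h1, h2, h3⟩ := exists_next ⟨k, hk, h⟩
  rwa [nextVal_eq h1 h2 h3]

theorem nextVal_succ {c : ℕ → ℝ} {n : ℕ} (h : c (n + 1) = 0) : nextVal c (n + 1) = nextVal c n := by
  by_cases hex : ∃ k, n + 1 < k ∧ c k ≠ 0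
  · obtain ⟨r, h1, h2, h3⟩ := exists_next hex
    rw [nextVal_eq h1 h2 h3, nextVal_eq (by omega : n < r) h2 fun k hk hk' => ?_]
    rcases (Nat.succ_le_of_lt hk).lt_or_eq with h4 | h4
    · exact h3 k h4 hk'
    · rw [← h4]; exact h
  · have hex' : ¬∃ k, n < k ∧ c k ≠ 0 := by
      rintro ⟨k, h1, h2⟩
      rcases (Nat.succ_le_of_lt h1).lt_or_eq with h4 | h4
      · exact hex ⟨k, h4, h2⟩
      · exact h2 (h4 ▸ h)
    rw [nextVal, nextVal, dif_neg hex, dif_neg hex']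

theorem gapVal_succ {c : ℕ → ℝ} {n : ℕ} (h0 : c n = 0) (h : c (n + 1) = 0) :
    gapVal c (n + 1) = gapVal c n := by
  rw [gapVal, gapVal, nextVal_succ h, lastVal, if_pos h0]

/-- From the start of the run of `l` up to `r` the only jumps are `c l` and `c r`, so block
domination reads `(c l + c r) ^ 2 ≤ c l ^ 2 + c r ^ 2`. -/
theorem mul_neg_of_gap {c : ℕ → ℝ} (hc : BlockDominated (jumps c)) {l r : ℕ} (hl : c l ≠ 0)
    (hr : c r ≠ 0) (hlr : l + 1 < r) (h0 : ∀ k, l < k → k < r → c k = 0) : c l * c r < 0 := by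
  have hjr : jumps c r = c r := by
    obtain ⟨p, rfl⟩ : ∃ p, r = p + 1 := ⟨r - 1, by omega⟩
    rw [jumps_succ, h0 p (by omega) (by omega), if_neg hr]
  have hsum : ∀ g : ℕ → ℝ, (∀ k, jumps c k = 0 → g k = 0) →
      ∑ k ∈ Finset.Icc (runStart c l) r, g k = g (runStart c l) + g r := by
    intro g hg
    have hle := runStart_le c l
    rw [← Finset.sum_pair (f := g) (show runStart c l ≠ r by omega)]
    refine (Finset.sum_subset (fun k hk => ?_) fun k hk hk' => hg k ?_).symm
    · rw [Finset.mem_Icc]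
      rcases Finset.mem_insert.1 hk with rfl | hk
      · omega
      · rw [Finset.mem_singleton.1 hk]; omega
    · simp only [Finset.mem_Icc, Finset.mem_insert, Finset.mem_singleton, not_or] at hk hk'
      rcases le_or_gt k l with h | h
      · exact jumps_eq_zero_of_between (n := l) (by omega) h
      · rw [jumps, h0 k h (by omega), ite_self]
  have h := hc (runStart c l) r
  rw [hsum _ fun _ h => h, hsum (fun k => jumps c k ^ 2) fun k h => by simp [h], hjr,
    jumps_runStart] at h
  exact lt_of_le_of_ne (by nlinarith) (mul_ne_zero hl hr)

theorem lastVal_mul_nextVal_neg {c : ℕ → ℝ} (hc : BlockDominated (jumps c)) {n : ℕ} (hn : c n = 0)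
    (hl : lastVal c n ≠ 0) (hr : nextVal c n ≠ 0) : lastVal c n * nextVal c n < 0 := by
  obtain ⟨l, h1, h2, h3⟩ := lastVal_spec hl
  obtain ⟨r, g1, g2, g3⟩ := nextVal_spec hr
  rw [← h2, ← g2]
  refine mul_neg_of_gap hc (by rwa [h2]) (by rwa [g2]) (by omega) fun k hk hk' => ?_
  rcases lt_trichotomy k n with h | rfl | h
  · exact h3 k hk h
  · exact hn
  · exact g3 k h hk'

/-- No gap of `c` between two nonzero values consists of exactly one point. -/
def NoUnitGap (c : ℕ → ℝ) : Prop := ∀ n, c n ≠ 0 → c (n + 1) = 0 → c (n + 2) = 0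

/-- With `γ = gapVal c`, a filled gap contributes a jump `-θγ` at its first point and `θγ` at its
second, and nothing afterwards. The original jumps survive because the filling has the opposite sign
at either border: `-γ` against the value before the gap, `γ` against the value after it. Only a gap
of length at least two allows both. -/
theorem jumps_add_smul_fill {c : ℕ → ℝ} (hc : BlockDominated (jumps c)) (hu : NoUnitGap c) {θ : ℝ}
    (hθ : 0 < θ) (n : ℕ) :
    jumps (c + θ • fill c) n = jumps c n + θ * (gapShift c n - gapStart c n) := by
  cases n with
  | zero => simp [jumps_zero, fill, gapShift, gapStart]
  | succ n =>
    simp only [jumps_succ, Pi.add_apply, Pi.smul_apply, smul_eq_mul, gapShift]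
    by_cases h1 : c (n + 1) = 0
    · have e1 : (if c (n + 1) = c n then (0 : ℝ) else c (n + 1)) = 0 := by rw [h1, ite_self]
      rw [e1, zero_add]
      by_cases h0 : c n = 0
      · rw [show fill c (n + 1) = gapVal c n by
            rw [fill, if_pos h1, if_pos h0, gapVal_succ h0 h1],
          show gapStart c (n + 1) = 0 by rw [gapStart, if_neg (by simp [h0])], h1, h0]
        cases n with
        | zero => simp [fill, gapStart, gapVal, lastVal]
        | succ p =>
          by_cases hp : c p = 0
          · simp [fill, gapStart, h0, hp]
          · simp only [fill, gapStart, h0, hp, if_true, if_false, ne_eq, not_false_eq_true, and_self,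
              zero_add, sub_zero]
            split_ifs with h
            · linarith
            · rfl
      · rw [show fill c (n + 1) = -gapVal c (n + 1) by rw [fill, if_pos h1, if_neg h0],
          show gapStart c (n + 1) = gapVal c (n + 1) by rw [gapStart, if_pos ⟨h1, h0⟩]]
        have e2 : fill c n = 0 := by cases n <;> simp [fill, h0]
        have e3 : gapStart c n = 0 := by cases n <;> simp [gapStart, h0]
        have e4 : lastVal c (n + 1) = c n := by rw [lastVal, if_neg h0]
        rw [e2, e3, h1, if_neg]
        · ring
        · rw [gapVal, e4]
          intro h
          have : c n * (1 + θ * |nextVal c (n + 1)|) = 0 := by linarith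
          rcases mul_eq_zero.1 this with h | h
          · exact h0 h
          · have := mul_nonneg hθ.le (abs_nonneg (nextVal c (n + 1)))
            linarith
    · have e1 : fill c (n + 1) = 0 := by rw [fill, if_neg h1]
      have e2 : gapStart c (n + 1) = 0 := by rw [gapStart, if_neg (by simp [h1])]
      have e3 : gapStart c n = 0 := by
        cases n with
        | zero => rfl
        | succ p =>
          rw [gapStart, if_neg]
          rintro ⟨h, h'⟩
          exact h1 (hu p h' h)
      rw [e1, e2, e3, sub_zero, mul_zero, add_zero, add_zero]
      by_cases h0 : c n = 0
      · have e4 : fill c n = gapVal c n := by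
          cases n with
          | zero => simp [fill, gapVal, lastVal]
          | succ p =>
            rw [fill, if_pos h0, if_pos]
            by_contra h
            exact h1 (hu p h h0)
        have e5 : nextVal c n = c (n + 1) := nextVal_eq n.lt_succ_self h1 fun k _ _ => by omega
        rw [h0, e4, zero_add, if_neg h1, if_neg]
        intro h
        rw [gapVal, e5] at h
        by_cases hl : lastVal c n = 0
        · rw [hl] at h
          exact h1 (by linarith)
        · have h2 := lastVal_mul_nextVal_neg hc h0 hl (by rwa [e5])
          rw [e5] at h2
          have h3 : 0 < c (n + 1) * c (n + 1) := mul_self_pos.2 h1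
          have h4 : c (n + 1) * c (n + 1) =
              θ * |c (n + 1)| * (lastVal c n * c (n + 1)) := by
            nth_rewrite 1 [h]; ring
          have h5 : 0 < θ * |c (n + 1)| := mul_pos hθ (abs_pos.2 h1)
          nlinarith
      · have e4 : fill c n = 0 := by cases n <;> simp [fill, h0]
        rw [e4, mul_zero, add_zero]

/-- Filling happens only between nonzero values of `c`, since `gapVal` vanishes before the first and
after the last of them. So a zero of `c` between two nonzero points of the new sequence lies in a
genuine gap and has been filled. -/
theorem noGap_add_smul_fill (c : ℕ → ℝ) {θ : ℝ} (hθ : 0 < θ) : NoGap (c + θ • fill c) := by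
  have hfill : ∀ n, c n ≠ 0 → fill c n = 0 := fun n hn => by cases n <;> simp [fill, hn]
  have hgap : ∀ n, fill c n ≠ 0 → gapVal c n ≠ 0 := fun n hn h => by
    cases n with
    | zero => exact hn rfl
    | succ n =>
      rw [fill, h, neg_zero, ite_self, ite_self] at hn
      exact hn rfl
  have hne : ∀ n, (c + θ • fill c) n ≠ 0 → c n ≠ 0 ∨ gapVal c n ≠ 0 := by
    intro n hn
    by_cases h : c n = 0
    · refine Or.inr (hgap n fun h' => hn ?_)
      simp [h, h']
    · exact Or.inl h
  intro i j k hij hjk hi hk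
  by_cases hj : c j = 0
  · have h1 : lastVal c j ≠ 0 := by
      rcases hne i hi with h | h
      · exact lastVal_ne_zero hij h
      · obtain ⟨l, h1, h2, -⟩ := lastVal_spec (left_ne_zero_of_mul h)
        exact lastVal_ne_zero (h1.trans hij) (h2 ▸ left_ne_zero_of_mul h)
    have h2 : nextVal c j ≠ 0 := by
      rcases hne k hk with h | h
      · exact nextVal_ne_zero hjk h
      · have h' : nextVal c k ≠ 0 := abs_ne_zero.1 (right_ne_zero_of_mul h)
        obtain ⟨r, h1, h2, -⟩ := nextVal_spec h'
        exact nextVal_ne_zero (hjk.trans h1) (h2 ▸ h')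
    have h3 : gapVal c j ≠ 0 := mul_ne_zero h1 (abs_ne_zero.2 h2)
    obtain ⟨p, rfl⟩ : ∃ p, j = p + 1 := ⟨j - 1, by omega⟩
    have h4 : fill c (p + 1) ≠ 0 := by
      rw [fill, if_pos hj]
      split_ifs
      · exact h3
      · exact neg_ne_zero.2 h3
    simp [hj, h4, hθ.ne']
  · simpa [hfill j hj] using hj

/-- The opposite signs of `c p` and `c r` give two expressions for one number: as a multiple of the
value before the gap, for blocks ending there, and of the value after it, for blocks starting there.
-/
theorem gapStart_spec {c : ℕ → ℝ} (hc : BlockDominated (jumps c)) {n : ℕ} (h : gapStart c n ≠ 0) :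
    ∃ p r, n = p + 1 ∧ n < r ∧ c p ≠ 0 ∧ c n = 0 ∧ c r ≠ 0 ∧ (∀ k, n < k → k < r → c k = 0) ∧
      gapStart c n = |c r| * c p ∧ gapStart c n = -(|c p| * c r) := by
  cases n with
  | zero => exact absurd rfl h
  | succ p =>
    rw [gapStart] at h ⊢
    by_cases hcond : c (p + 1) = 0 ∧ c p ≠ 0
    · rw [if_pos hcond] at h ⊢
      have hl : lastVal c (p + 1) = c p := by rw [lastVal, if_neg hcond.2]
      have hr : nextVal c (p + 1) ≠ 0 := abs_ne_zero.1 (right_ne_zero_of_mul h)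
      obtain ⟨r, h1, h2, h3⟩ := nextVal_spec hr
      have hneg := lastVal_mul_nextVal_neg hc hcond.1 (by rw [hl]; exact hcond.2) hr
      rw [gapVal, hl, ← h2]
      rw [hl, ← h2] at hneg
      refine ⟨p, r, rfl, h1, hcond.2, hcond.1, h2 ▸ hr, h3, mul_comm _ _, ?_⟩
      rcases mul_neg_iff.1 hneg with ⟨g1, g2⟩ | ⟨g1, g2⟩
      · rw [abs_of_neg g2, abs_of_pos g1]; ring
      · rw [abs_of_pos g2, abs_of_neg g1]; ring
    · rw [if_neg hcond] at h
      exact absurd rfl h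

theorem gapShift_mul_gapStart (c : ℕ → ℝ) (n : ℕ) : gapShift c n * gapStart c n = 0 := by
  cases n with
  | zero => simp [gapShift]
  | succ n =>
    cases n with
    | zero => simp [gapShift, gapStart]
    | succ n =>
      simp only [gapShift, gapStart]
      by_cases h : c (n + 1) = 0 <;> simp [h]

theorem jumps_mul_gap {c : ℕ → ℝ} (hu : NoUnitGap c) (n : ℕ) :
    jumps c n * (gapShift c n - gapStart c n) = 0 := by
  by_cases hn : c n = 0
  · rw [jumps, hn, ite_self, zero_mul]
  · have h1 : gapStart c n = 0 := by cases n <;> simp [gapStart, hn]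
    have h2 : gapShift c n = 0 := by
      match n with
      | 0 => rfl
      | 1 => rfl
      | n + 2 =>
        rw [gapShift, gapStart, if_neg]
        rintro ⟨h, h'⟩
        exact hn (hu n h' h)
    rw [h1, h2, sub_zero, mul_zero]

theorem sum_gap (c : ℕ → ℝ) {u v : ℕ} (huv : u ≤ v) :
    ∑ k ∈ Finset.Icc u v, (gapShift c k - gapStart c k) = gapShift c u - gapStart c v := by
  induction v, huv using Nat.le_induction with
  | base => simp
  | succ v huv ih =>
    rw [Finset.sum_Icc_succ_top (by omega), ih, gapShift]
    ring

theorem sq_jumps_add {c : ℕ → ℝ} (hu : NoUnitGap c) (θ : ℝ) (n : ℕ) :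
    (jumps c n + θ * (gapShift c n - gapStart c n)) ^ 2 =
      jumps c n ^ 2 + θ ^ 2 * (gapShift c n ^ 2 + gapStart c n ^ 2) := by
  linear_combination 2 * θ * jumps_mul_gap hu n - 2 * θ ^ 2 * gapShift_mul_gapStart c n

/-- The added jumps telescope, so a block sum changes only if `u` is the second point of a gap or
`v` is the first point of one. The change then subtracts a fraction `θ|c q|` of the first jump or
`θ|c s|` of the last jump in the block, and `BlockDominated.sq_add_ends_le` absorbs it into the
added energy. A bound `1` on the coordinates keeps these fractions in `[0, 1]`. -/
theorem blockDominated_add_smul_fill {c : ℕ → ℝ} (hc : BlockDominated (jumps c))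
    (hc1 : ∀ n, |c n| ≤ 1) (hu : NoUnitGap c) {θ : ℝ} (hθ : 0 < θ) (hθ1 : θ ≤ 1) :
    BlockDominated (jumps (c + θ • fill c)) := by
  intro u v
  rcases lt_or_ge v u with huv | huv
  · simp [Finset.Icc_eq_empty_of_lt huv]
  simp only [jumps_add_smul_fill hc hu hθ, sq_jumps_add hu]
  rw [Finset.sum_add_distrib, ← Finset.mul_sum, sum_gap c huv, Finset.sum_add_distrib,
    ← Finset.mul_sum, Finset.sum_add_distrib]
  have hA := Finset.single_le_sum (f := fun k => gapShift c k ^ 2) (fun _ _ => sq_nonneg _)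
    (Finset.left_mem_Icc.2 huv)
  have hB := Finset.single_le_sum (f := fun k => gapStart c k ^ 2) (fun _ _ => sq_nonneg _)
    (Finset.right_mem_Icc.2 huv)
  suffices h : (∑ k ∈ Finset.Icc u v, jumps c k + θ * (gapShift c u - gapStart c v)) ^ 2 ≤
      ∑ k ∈ Finset.Icc u v, jumps c k ^ 2 + (θ * gapShift c u) ^ 2 + (θ * gapStart c v) ^ 2 by
    nlinarith [sq_nonneg θ]
  have hj0 : ∀ k, c k = 0 → jumps c k = 0 := fun k hk => by rw [jumps, hk, ite_self]
  have hsq := Finset.sum_nonneg fun k (_ : k ∈ Finset.Icc u v) => sq_nonneg (jumps c k)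
  have hlam : ∀ n, 0 ≤ θ * |c n| ∧ θ * |c n| ≤ 1 := fun n =>
    ⟨by positivity, mul_le_one₀ hθ1 (abs_nonneg _) (hc1 n)⟩
  have hleft : (gapShift c u = 0) ∨ ∃ p q r, u = p + 1 ∧ p = q + 1 ∧ p < r ∧ c p = 0 ∧ c r ≠ 0 ∧
      (∀ k, p < k → k < r → c k = 0) ∧ gapShift c u = -(|c q| * c r) := by
    by_cases h : gapShift c u = 0
    · exact Or.inl h
    · right
      cases u with
      | zero => exact absurd rfl h
      | succ p =>
        obtain ⟨q, r, h1, h2, -, h4, h5, h6, -, h8⟩ := gapStart_spec hc (n := p) h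
        exact ⟨p, q, r, rfl, h1, h2, h4, h5, h6, h8⟩
  have hright : (gapStart c v = 0) ∨ ∃ q s, v = q + 1 ∧ c q ≠ 0 ∧ c v = 0 ∧
      gapStart c v = |c s| * c q := by
    by_cases h : gapStart c v = 0
    · exact Or.inl h
    · obtain ⟨q, r, h1, -, h3, h4, -, -, h7, -⟩ := gapStart_spec hc h
      exact Or.inr ⟨q, r, h1, h3, h4, h7⟩
  have hjr : ∀ {p r}, p < r → c p = 0 → c r ≠ 0 → (∀ k, p < k → k < r → c k = 0) →
      jumps c r = c r := by
    intro p r hpr hp hr h0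
    obtain ⟨m, rfl⟩ : ∃ m, r = m + 1 := ⟨r - 1, by omega⟩
    have hm : c m = 0 := by
      rcases (Nat.lt_succ_iff.1 hpr).lt_or_eq with h | rfl
      · exact h0 m h (by omega)
      · exact hp
    rw [jumps_succ, hm, if_neg hr]
  have hrun0 : ∀ {q}, v = q + 1 → c v = 0 → ∀ k, runStart c q < k → k ≤ v → jumps c k = 0 := by
    rintro q hq hv k h1 h2
    rcases h2.lt_or_eq with h3 | rfl
    · exact jumps_eq_zero_of_between h1 (by omega)
    · exact hj0 _ hv
  rcases hleft with hL | ⟨p, q, r, hup, hpq, hpr, hcp, hcr, hpr0, hL⟩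
  · rcases hright with hR | ⟨q', s, hvq, hcq, hcv, hR⟩
    · rw [hL, hR]
      simpa using hc u v
    · rcases le_or_gt u (runStart c q') with hle | hlt
      · have hrl := runStart_le c q'
        have := hc.sq_add_ends_le (u := u) (v := v) (r := u) (l := runStart c q') (s := 0)
          (t := θ * |c s|) le_rfl zero_le_one (hlam s).1 (hlam s).2 le_rfl huv hle (by omega)
          (fun k h1 h2 => by omega) (hrun0 hvq hcv)
        rw [jumps_runStart] at this
        rw [hL, hR]
        convert this using 1 <;> ring
      -- The block starts after the beginning of the last run and ends at the zero following that
      -- run, so it contains no jump of `c`.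
      · have h0 : ∀ k ∈ Finset.Icc u v, jumps c k = 0 := fun k hk => by
          rw [Finset.mem_Icc] at hk
          exact hrun0 hvq hcv k (by omega) hk.2
        rw [Finset.sum_eq_zero h0, hL]
        nlinarith
  · have hzero : ∀ k, u ≤ k → k < r → jumps c k = 0 := fun k h1 h2 => hj0 k (hpr0 k (by omega) h2)
    rcases le_or_gt r v with hrv | hrv
    · rcases hright with hR | ⟨q', s, hvq, hcq, hcv, hR⟩
      · have := hc.sq_add_ends_le (u := u) (v := v) (r := r) (l := v) (s := θ * |c q|)
          (t := 0) (hlam q).1 (hlam q).2 le_rfl zero_le_one (by omega) hrv huv le_rfl hzero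
          (fun k h1 h2 => by omega)
        rw [hjr hpr hcp hcr hpr0] at this
        rw [hL, hR]
        convert this using 1 <;> ring
      -- Otherwise the run of `q'` would reach back to `p`, where `c` vanishes.
      · have hle : u ≤ runStart c q' := by
          by_contra hlt
          refine hcq ?_
          rw [← apply_runStart c q', ← runStart_eq_of_between (c := c) (k := p) (n := q')
            (by omega) (by omega), apply_runStart c p, hcp]
        have hrl := runStart_le c q'
        have := hc.sq_add_ends_le (u := u) (v := v) (r := r) (l := runStart c q')
          (s := θ * |c q|) (t := θ * |c s|) (hlam q).1 (hlam q).2 (hlam s).1 (hlam s).2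
          (by omega) hrv hle (by omega) hzero (hrun0 hvq hcv)
        rw [hjr hpr hcp hcr hpr0, jumps_runStart] at this
        rw [hL, hR]
        convert this using 1 <;> ring
    -- Now `[u, v]` lies inside a single gap, beyond its first point.
    · have hR : gapStart c v = 0 := by
        rcases hright with hR | ⟨q', s, hvq, hcq, hcv, hR⟩
        · exact hR
        · exfalso
          refine hcq ?_
          rcases (show p ≤ q' by omega).eq_or_lt with rfl | h
          · exact hcp
          · exact hpr0 q' h (by omega)
      have h0 : ∀ k ∈ Finset.Icc u v, jumps c k = 0 := fun k hk => by
        rw [Finset.mem_Icc] at hk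
        exact hzero k hk.1 (by omega)
      rw [Finset.sum_eq_zero h0, hR]
      nlinarith

/-- The value of a run may be counted at its last point instead of its first; `c N ^ 2` accounts for
the run cut off at `N`. A gap starts right after the last point of a run, so this form bounds the
corrections. -/
theorem sum_runEnd_sq (c : ℕ → ℝ) (N : ℕ) :
    ∑ n ∈ Finset.range N, (if c (n + 1) = c n then 0 else c n ^ 2) + c N ^ 2 =
      ∑ n ∈ Finset.range (N + 1), jumps c n ^ 2 := by
  induction N with
  | zero => simp [jumps_zero]
  | succ N ih =>
    rw [Finset.sum_range_succ, Finset.sum_range_succ _ (N + 1), ← ih, jumps_succ]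
    split_ifs with h
    · rw [h]; ring
    · ring

theorem sum_gapStart_sq_le {c : ℕ → ℝ} {B : ℝ} (hB : ∀ N, ∑ n ∈ Finset.range N, jumps c n ^ 2 ≤ B)
    (hc1 : ∀ n, |c n| ≤ 1) (N : ℕ) : ∑ n ∈ Finset.range N, gapStart c n ^ 2 ≤ B := by
  cases N with
  | zero => simpa using hB 0
  | succ N =>
    rw [Finset.sum_range_succ', gapStart]
    have h := sum_runEnd_sq c N
    have h1 : ∑ n ∈ Finset.range N, gapStart c (n + 1) ^ 2 ≤
        ∑ n ∈ Finset.range N, (if c (n + 1) = c n then 0 else c n ^ 2) := by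
      refine Finset.sum_le_sum fun n _ => ?_
      rw [gapStart]
      by_cases hcond : c (n + 1) = 0 ∧ c n ≠ 0
      · rw [if_pos hcond, if_neg (by rw [hcond.1]; exact hcond.2.symm), gapVal, lastVal,
          if_neg hcond.2, mul_pow]
        refine mul_le_of_le_one_right (sq_nonneg _) ?_
        rw [sq_abs, sq_le_one_iff_abs_le_one]
        by_cases hr : nextVal c (n + 1) = 0
        · simp [hr]
        · obtain ⟨r, -, h2, -⟩ := nextVal_spec hr
          rw [← h2]
          exact hc1 r
      · rw [if_neg hcond, zero_pow two_ne_zero]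
        split_ifs <;> first | exact sq_nonneg _ | exact le_rfl
    have h2 := hB (N + 1)
    nlinarith [sq_nonneg (c N)]

theorem sum_gapShift_sq_le {c : ℕ → ℝ} {B : ℝ}
    (hB : ∀ N, ∑ n ∈ Finset.range N, gapStart c n ^ 2 ≤ B) (N : ℕ) :
    ∑ n ∈ Finset.range N, gapShift c n ^ 2 ≤ B := by
  cases N with
  | zero => simpa using hB 0
  | succ N =>
    rw [Finset.sum_range_succ']
    simpa [gapShift] using hB N

theorem mem_closure_extDualBall {f : StrongDual ℝ JamesSpace}
    (hQ : ∀ N, ∑ n ∈ Finset.range N, jumps (coords f) n ^ 2 ≤ 1) (hf : ‖f‖ = 1)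
    (hu : NoUnitGap (coords f)) : f ∈ closure extDualBall := by
  have hbd := blockDominated_jumps hQ hf
  have hsum := hasSum_jumps_sq hQ hf
  have hc1 : ∀ n, |coords f n| ≤ 1 := fun n => hf ▸ abs_coords_le f n
  have hG := sum_gapStart_sq_le hQ hc1
  have hS := sum_gapShift_sq_le hG
  have hle : ∀ θ : ℝ, 0 < θ → ∀ N,
      ∑ n ∈ Finset.range N, jumps (coords f + θ • fill (coords f)) n ^ 2 ≤ 1 + 2 * θ ^ 2 := by
    intro θ hθ N
    simp only [jumps_add_smul_fill hbd hu hθ, sq_jumps_add hu]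
    rw [Finset.sum_add_distrib, ← Finset.mul_sum, Finset.sum_add_distrib]
    nlinarith [hQ N, hG N, hS N, sq_nonneg θ]
  -- The filling is realised once, as `g - f` with `θ = 1`; then `f + θ • (g - f)` converges to `f`
  -- in norm as `θ → 0`.
  obtain ⟨g, hg⟩ := exists_coords_eq (hle 1 one_pos)
  have hcoords : ∀ θ : ℝ, coords (f + θ • (g - f)) = coords f + θ • fill (coords f) := fun θ => by
    rw [coords_add, coords_smul, coords_sub, hg, one_smul, add_sub_cancel_left]
  have hq : ∀ θ : ℝ, 0 < θ → θ ≤ 1 → ∃ q : ℝ, 1 ≤ q ∧ q ≤ 1 + 2 * θ ^ 2 ∧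
      (1 / √q) • (f + θ • (g - f)) ∈ extDualBall := by
    intro θ hθ hθ1
    have hs : Summable fun n => jumps (coords f + θ • fill (coords f)) n ^ 2 :=
      summable_of_sum_range_le (fun _ => sq_nonneg _) (hle θ hθ)
    have h1 : 1 ≤ ∑' n, jumps (coords f + θ • fill (coords f)) n ^ 2 := by
      refine hasSum_le (fun n => ?_) hsum hs.hasSum
      rw [jumps_add_smul_fill hbd hu hθ, sq_jumps_add hu]
      have : 0 ≤ θ ^ 2 * (gapShift (coords f) n ^ 2 + gapStart (coords f) n ^ 2) := by positivity
      linarith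
    refine ⟨_, h1, Real.tsum_le_of_sum_range_le (fun _ => sq_nonneg _) (hle θ hθ),
      smul_mem_extDualBall (by linarith) ?_ ?_ ?_⟩
    · rw [hcoords]; exact hs.hasSum
    · rw [hcoords]; exact blockDominated_add_smul_fill hbd hc1 hu hθ hθ1
    · rw [hcoords]; exact noGap_add_smul_fill _ hθ
  have hθ : ∀ k : ℕ, (0 : ℝ) < 1 / ((k : ℝ) + 1) ∧ 1 / ((k : ℝ) + 1) ≤ 1 := fun k =>
    ⟨Nat.one_div_pos_of_nat, by
      rw [div_le_one (by positivity)]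
      have : (0 : ℝ) ≤ k := k.cast_nonneg
      linarith⟩
  choose q hq1 hq2 hmem using fun k : ℕ => hq _ (hθ k).1 (hθ k).2
  have hθ0 := tendsto_one_div_add_atTop_nhds_zero_nat (𝕜 := ℝ)
  have hqlim : Tendsto q atTop (𝓝 1) := by
    refine tendsto_of_tendsto_of_tendsto_of_le_of_le tendsto_const_nhds ?_ hq1 hq2
    simpa using ((hθ0.pow 2).const_mul 2).const_add 1
  have hlim : Tendsto (fun k : ℕ => (1 / √(q k)) • (f + (1 / ((k : ℝ) + 1)) • (g - f))) atTop
      (𝓝 ((1 / √1) • (f + (0 : ℝ) • (g - f)))) :=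
    (tendsto_const_nhds.div hqlim.sqrt (by simp)).smul ((hθ0.smul_const (g - f)).const_add f)
  have heq : (1 / √1 : ℝ) • (f + (0 : ℝ) • (g - f)) = f := by simp
  rw [heq] at hlim
  exact mem_closure_of_tendsto hlim (Eventually.of_forall hmem)

/-! ### Limits of extreme points -/

theorem jumps_add_single_left_sq_le {d : ℕ → ℝ} {n : ℕ} (h1 : d (n + 1) ≠ d n)
    (h2 : d (n + 2) ≠ d (n + 1)) (k : ℕ) :
    jumps (d + (d n - d (n + 1)) • Pi.single (n + 1) 1) k ^ 2 ≤ jumps d k ^ 2 := by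
  set d' := d + (d n - d (n + 1)) • (Pi.single (n + 1) 1 : ℕ → ℝ) with hd'
  have hne : ∀ k, k ≠ n + 1 → d' k = d k := fun k hk => by simp [hd', hk]
  have heq : d' (n + 1) = d n := by simp [hd']
  cases k with
  | zero => rw [jumps_zero, jumps_zero, hne 0 (by omega)]
  | succ k =>
    rw [jumps_succ, jumps_succ]
    rcases eq_or_ne k n with rfl | hk
    · rw [heq, hne k (by omega), if_pos rfl, zero_pow two_ne_zero]
      exact sq_nonneg _
    · rw [hne (k + 1) (by omega)]
      rcases eq_or_ne k (n + 1) with rfl | hk'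
      · rw [if_neg h2]
        split_ifs
        · rw [zero_pow two_ne_zero]; exact sq_nonneg _
        · exact le_rfl
      · rw [hne k hk']

/-- Giving position `n + 1` the value of `n + 2` moves the jump at `n + 2` one place to the left.
The comparison therefore holds term by term only after swapping the two indices. -/
theorem sum_jumps_add_single_right_sq_le {d : ℕ → ℝ} {n : ℕ}
    (h2 : d (n + 2) ≠ d (n + 1)) {B : ℝ} (hB : ∀ N, ∑ k ∈ Finset.range N, jumps d k ^ 2 ≤ B)
    (N : ℕ) : ∑ k ∈ Finset.range N,
      jumps (d + (d (n + 2) - d (n + 1)) • Pi.single (n + 1) 1) k ^ 2 ≤ B := by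
  set d' := d + (d (n + 2) - d (n + 1)) • (Pi.single (n + 1) 1 : ℕ → ℝ) with hd'
  have hne : ∀ k, k ≠ n + 1 → d' k = d k := fun k hk => by simp [hd', hk]
  have heq : d' (n + 1) = d (n + 2) := by simp [hd']
  have hpt : ∀ k, jumps d' k ^ 2 ≤ jumps d (Equiv.swap (n + 1) (n + 2) k) ^ 2 := by
    intro k
    rcases eq_or_ne k (n + 1) with rfl | hk
    · rw [Equiv.swap_apply_left, jumps_succ, jumps_succ, heq, if_neg h2]
      split_ifs
      · rw [zero_pow two_ne_zero]; exact sq_nonneg _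
      · exact le_rfl
    · rcases eq_or_ne k (n + 2) with rfl | hk'
      · rw [jumps_succ, heq, hne (n + 1 + 1) (by omega), if_pos rfl, zero_pow two_ne_zero]
        exact sq_nonneg _
      · rw [Equiv.swap_apply_of_ne_of_ne hk hk']
        cases k with
        | zero => rw [jumps_zero, jumps_zero, hne 0 (by omega)]
        | succ k => rw [jumps_succ, jumps_succ, hne (k + 1) hk, hne k (by omega)]
  have hle : N ≤ max N (n + 3) := le_max_left _ _
  refine (Finset.sum_le_sum_of_subset_of_nonneg (Finset.range_mono hle)
    fun _ _ _ => sq_nonneg _).trans ((Finset.sum_le_sum fun k _ => hpt k).trans ?_)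
  rw [Equiv.Perm.sum_comp (Equiv.swap (n + 1) (n + 2)) (Finset.range (max N (n + 3)))
    fun k => jumps d k ^ 2]
  · exact hB _
  · intro k hk
    have : k = n + 1 ∨ k = n + 2 := by
      by_contra! h
      exact hk (Equiv.swap_apply_of_ne_of_ne h.1 h.2)
    rw [Finset.mem_coe, Finset.mem_range]
    omega

/-- The sign condition says that the middle coordinate lies strictly between its neighbours. Setting
it equal to either neighbour keeps `Q ≤ 1`, hence stays in the ball, and `e` is a proper convex
combination of the two results. -/
theorem not_mem_extDualBall {e : StrongDual ℝ JamesSpace} {n : ℕ}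
    (h : (coords e n - coords e (n + 1)) * (coords e (n + 2) - coords e (n + 1)) < 0) :
    e ∉ extDualBall := by
  intro he
  have hQ := sum_jumps_sq_le_of_mem_extDualBall he
  set a := coords e n - coords e (n + 1) with ha
  set b := coords e (n + 2) - coords e (n + 1) with hb
  have ha0 : a ≠ 0 := fun h0 => by rw [h0, zero_mul] at h; exact lt_irrefl _ h
  have hb0 : b ≠ 0 := fun h0 => by rw [h0, mul_zero] at h; exact lt_irrefl _ h
  have h1 : coords e (n + 1) ≠ coords e n := fun h0 => ha0 (by rw [ha, h0, sub_self])
  have h2 : coords e (n + 2) ≠ coords e (n + 1) := fun h0 => hb0 (by rw [hb, h0, sub_self])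
  have hball : ∀ r : ℝ, (∀ N, ∑ k ∈ Finset.range N,
      jumps (coords e + r • Pi.single (n + 1) 1) k ^ 2 ≤ 1) →
      e + r • coordFunctional (n + 1) ∈ Metric.closedBall (0 : StrongDual ℝ JamesSpace) 1 := by
    intro r hr
    rw [mem_closedBall_zero_iff]
    refine (norm_le_sqrt (B := 1) ?_).trans_eq Real.sqrt_one
    rwa [coords_add, coords_smul, coords_coordFunctional]
  have hA := hball a fun N =>
    (Finset.sum_le_sum fun k _ => jumps_add_single_left_sq_le h1 h2 k).trans (hQ N)
  have hB := hball b fun N => sum_jumps_add_single_right_sq_le h2 hQ N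
  have hseg : e ∈ openSegment ℝ (e + a • coordFunctional (n + 1))
      (e + b • coordFunctional (n + 1)) := by
    have hab : b - a ≠ 0 := fun h0 => by
      rw [sub_eq_zero.1 h0] at h
      exact (mul_self_nonneg a).not_gt h
    have hd : 0 < (b - a) ^ 2 := by positivity
    -- These weights are `b / (b - a)` and `-a / (b - a)`, written so that `a * b < 0` makes both
    -- numerators and the denominator visibly positive.
    refine ⟨(b ^ 2 - a * b) / (b - a) ^ 2, (a ^ 2 - a * b) / (b - a) ^ 2, ?_, ?_, ?_, ?_⟩
    · exact div_pos (by nlinarith [sq_nonneg b]) hd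
    · exact div_pos (by nlinarith [sq_nonneg a]) hd
    · rw [← add_div, div_eq_one_iff_eq hd.ne']; ring
    · have k1 : (b ^ 2 - a * b) / (b - a) ^ 2 + (a ^ 2 - a * b) / (b - a) ^ 2 = 1 := by
        rw [← add_div, div_eq_one_iff_eq hd.ne']; ring
      have k2 : (b ^ 2 - a * b) / (b - a) ^ 2 * a + (a ^ 2 - a * b) / (b - a) ^ 2 * b = 0 := by
        rw [div_mul_eq_mul_div, div_mul_eq_mul_div, ← add_div]
        rw [div_eq_zero_iff]; left; ring
      rw [smul_add, smul_add, smul_smul, smul_smul, add_add_add_comm, ← add_smul, ← add_smul, k1,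
        k2, one_smul, zero_smul, add_zero]
  have hfin := (mem_extremePoints_iff_left.1 he).2 _ hA _ hB hseg
  have h3 := congrFun (congrArg coords hfin) (n + 1)
  rw [coords_add, coords_smul, coords_coordFunctional] at h3
  simp only [Pi.add_apply, Pi.smul_apply, Pi.single_eq_same, smul_eq_mul, mul_one] at h3
  exact ha0 (by linarith)

theorem continuous_coords (n : ℕ) : Continuous fun f : StrongDual ℝ JamesSpace => coords f n :=
  (ContinuousLinearMap.apply ℝ ℝ (unitVec n)).continuous

theorem noUnitGap_of_mem_closure {f : StrongDual ℝ JamesSpace}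
    (hQ : ∀ N, ∑ n ∈ Finset.range N, jumps (coords f) n ^ 2 ≤ 1) (hf : ‖f‖ = 1)
    (hcl : f ∈ closure extDualBall) : NoUnitGap (coords f) := by
  intro n h0 h1
  by_contra h2
  have hneg := mul_neg_of_gap (blockDominated_jumps hQ hf) h0 h2 (by omega) fun k hk hk' => by
    rwa [show k = n + 1 by omega]
  have hopen : IsOpen {e : StrongDual ℝ JamesSpace |
      (coords e n - coords e (n + 1)) * (coords e (n + 2) - coords e (n + 1)) < 0} :=
    isOpen_lt (((continuous_coords n).sub (continuous_coords _)).mul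
      ((continuous_coords _).sub (continuous_coords _))) continuous_const
  obtain ⟨e, he, he'⟩ := mem_closure_iff.1 hcl _ hopen (by
    rwa [Set.mem_ofPred_eq, h1, sub_zero, sub_zero])
  exact not_mem_extDualBall he he'

theorem mem_closure_extDualBall_iff {f : StrongDual ℝ JamesSpace} (hf₁ : f ∈ setD₁)
    (hf : ‖f‖ = 1) : f ∈ closure extDualBall ↔ NoUnitGap (coords f) :=
  ⟨noUnitGap_of_mem_closure (sum_jumps_sq_le_of_mem_setD₁ hf₁) hf,
    mem_closure_extDualBall (sum_jumps_sq_le_of_mem_setD₁ hf₁) hf⟩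

/-! ### The gap function -/

section GapFunction

variable {F : Set ℕ} {I : ℕ → NatInterval} {α : ℕ → ℝ} {f : StrongDual ℝ JamesSpace}

theorem hi_lt_lo (hF : IsLowerSet F) (hI : ∀ i, i + 1 ∈ F → (I i).hi < ((I (i + 1)).lo : ℕ∞))
    {i j : ℕ} (hij : i < j) (hj : j ∈ F) : (I i).hi < ((I j).lo : ℕ∞) := by
  induction j, hij using Nat.le_induction with
  | base => exact hI i hj
  | succ j hij ih =>
    exact (ih (hF j.le_succ hj)).trans ((I j).lo_le_hi.trans_lt (hI j hj))

theorem coords_eq_of_mem (hF : IsLowerSet F)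
    (hI : ∀ i, i + 1 ∈ F → (I i).hi < ((I (i + 1)).lo : ℕ∞))
    (hf : HasSum (fun i : F => α i • intervalFunctional (I i)) f) {i n : ℕ} (hi : i ∈ F)
    (hn : n ∈ (I i).points) : coords f n = α i := by
  have h := (ContinuousLinearMap.apply ℝ ℝ (unitVec n)).hasSum hf
  refine h.unique ?_
  have h2 : ∀ j : F, j ≠ ⟨i, hi⟩ → n ∉ (I j).points := by
    rintro ⟨j, hj⟩ hne hnj
    have hne' : j ≠ i := fun h => hne (Subtype.ext h)
    rcases lt_or_gt_of_ne hne' with hlt | hlt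
    · have := (hnj.2.trans_lt (hi_lt_lo hF hI hlt hi))
      exact absurd hn.1 (not_le.2 (by exact_mod_cast this))
    · have := (hn.2.trans_lt (hi_lt_lo hF hI hlt hj))
      exact absurd hnj.1 (not_le.2 (by exact_mod_cast this))
  have hval : ∀ j : F, (ContinuousLinearMap.apply ℝ ℝ (unitVec n))
      (α j • intervalFunctional (I j)) = α j * (I j).points.indicator 1 n := fun j => by
    rw [← coords_intervalFunctional]; rfl
  have h3 := hasSum_single (f := fun j : F => (ContinuousLinearMap.apply ℝ ℝ (unitVec n))
      (α j • intervalFunctional (I j))) ⟨i, hi⟩ fun j hj => by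
    rw [hval, Set.indicator_of_notMem (h2 j hj), mul_zero]
  rw [hval, Set.indicator_of_mem hn, Pi.one_apply, mul_one] at h3
  exact h3

theorem coords_eq_zero (hf : HasSum (fun i : F => α i • intervalFunctional (I i)) f) {n : ℕ}
    (hn : ∀ i ∈ F, n ∉ (I i).points) : coords f n = 0 := by
  have h := (ContinuousLinearMap.apply ℝ ℝ (unitVec n)).hasSum hf
  refine h.unique ?_
  have hval : ∀ j : F, (ContinuousLinearMap.apply ℝ ℝ (unitVec n))
      (α j • intervalFunctional (I j)) = 0 := fun j => by
    have : (ContinuousLinearMap.apply ℝ ℝ (unitVec n))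
      (α j • intervalFunctional (I j)) = α j * (I j).points.indicator 1 n := by
      rw [← coords_intervalFunctional]; rfl
    rw [this, Set.indicator_of_notMem (hn j j.2), mul_zero]
  have hfun := funext hval
  change HasSum (fun j : F => _) _
  rw [hfun]
  exact hasSum_zero

/-- The nonzero coordinates of `f` are exactly the points of the intervals, so a lone zero between
two nonzero coordinates is a gap of length one between two intervals, which have to be consecutive.
-/
theorem noUnitGap_iff (hF : IsLowerSet F)
    (hI : ∀ i, i + 1 ∈ F → (I i).hi < ((I (i + 1)).lo : ℕ∞)) (hα : ∀ i ∈ F, α i ≠ 0)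
    (hf : HasSum (fun i : F => α i • intervalFunctional (I i)) f) :
    NoUnitGap (coords f) ↔ 1 ∉ gapFunction F I '' F := by
  constructor
  · rintro hu ⟨i, hi, hgap⟩
    by_cases hi1 : i + 1 ∈ F
    · rw [gapFunction, if_pos hi1] at hgap
      have hlt := hI i hi1
      obtain ⟨h, hh⟩ := ENat.ne_top_iff_exists.1 (ne_top_of_lt hlt)
      rw [← hh, ENat.toNat_natCast] at hgap
      have hlo : (I (i + 1)).lo = h + 2 := by omega
      have m1 : h ∈ (I i).points := ⟨by
        have := (I i).lo_le_hi
        rw [← hh] at this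
        exact_mod_cast this, hh.le⟩
      have m2 : h + 2 ∈ (I (i + 1)).points := ⟨hlo.le, by rw [← hlo]; exact (I (i + 1)).lo_le_hi⟩
      refine hα _ hi1 ?_
      rw [← coords_eq_of_mem hF hI hf hi1 m2]
      refine hu h ?_ (coords_eq_zero hf fun j hj hmem => ?_)
      · rw [coords_eq_of_mem hF hI hf hi m1]
        exact hα i hi
      · rcases lt_trichotomy j (i + 1) with hji | rfl | hji
        · have hle : (I j).hi ≤ (I i).hi := by
            rcases (Nat.lt_succ_iff.1 hji).eq_or_lt with rfl | h
            · rfl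
            · exact (hi_lt_lo hF hI h hi).le.trans (I i).lo_le_hi
          have := hmem.2.trans hle
          rw [← hh] at this
          have : h + 1 ≤ h := by exact_mod_cast this
          omega
        · have := hmem.1
          omega
        · have h1 := (I (i + 1)).lo_le_hi.trans_lt (hi_lt_lo hF hI hji hj)
          have h2 : (I (i + 1)).lo < (I j).lo := by exact_mod_cast h1
          have := hmem.1
          omega
    · rw [gapFunction, if_neg hi1] at hgap
      exact zero_ne_one hgap
  · intro hgap n h0 h1
    by_contra h2
    have hex : ∀ m, coords f m ≠ 0 → ∃ i ∈ F, m ∈ (I i).points := fun m hm => by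
      by_contra! hc
      exact hm (coords_eq_zero hf hc)
    have hno : ∀ i ∈ F, n + 1 ∉ (I i).points := fun i hi hmem =>
      hα i hi ((coords_eq_of_mem hF hI hf hi hmem).symm.trans h1)
    obtain ⟨i, hi, hni⟩ := hex n h0
    obtain ⟨j, hj, hnj⟩ := hex (n + 2) h2
    have hhi : (I i).hi = n := by
      refine le_antisymm ?_ hni.2
      have : ¬((n + 1 : ℕ) : ℕ∞) ≤ (I i).hi := fun h => hno i hi ⟨hni.1.trans n.le_succ, h⟩
      exact Order.le_of_lt_add_one (by exact_mod_cast not_le.1 this)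
    have hij : i < j := by
      rcases lt_trichotomy i j with h | rfl | h
      · exact h
      · have h3 := hnj.2
        rw [hhi] at h3
        have : n + 2 ≤ n := by exact_mod_cast h3
        omega
      · have h3 := hnj.2.trans_lt (hi_lt_lo hF hI h hi)
        have : n + 2 < (I i).lo := by exact_mod_cast h3
        have := hni.1
        omega
    -- An interval after `I i` starts beyond `n`, and it cannot start at `n + 1`, which is not
    -- covered. Two intervals cannot both start at `n + 2`, whence `j = i + 1`.
    have hlo : ∀ k ∈ F, i < k → (I k).lo ≤ n + 2 → (I k).lo = n + 2 := by
      intro k hk hik hle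
      have h3 := hi_lt_lo hF hI hik hk
      rw [hhi] at h3
      have h4 : n < (I k).lo := by exact_mod_cast h3
      by_contra hne
      have h5 : (I k).lo = n + 1 := by omega
      exact hno k hk ⟨h5.le, by rw [← h5]; exact (I k).lo_le_hi⟩
    have hji : j = i + 1 := by
      by_contra hne
      have h3 := hi_lt_lo hF hI (show i + 1 < j by omega) hj
      have h4 := (I (i + 1)).lo_le_hi.trans_lt h3
      have h5 : (I (i + 1)).lo < (I j).lo := by exact_mod_cast h4
      have h6 := hnj.1
      have h7 := hlo (i + 1) (hF (by omega : i + 1 ≤ j) hj) (by omega) (by omega)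
      omega
    subst hji
    refine hgap ⟨i, hi, ?_⟩
    rw [gapFunction, if_pos hj, hlo (i + 1) hj (by omega) hnj.1, hhi, ENat.toNat_natCast]
    omega

end GapFunction

/-! ### Functionals supported on the first four coordinates -/

/-- The functional with the coordinates `a, b, c, d, 0, 0, …`. -/
def quad (a b c d : ℝ) : StrongDual ℝ JamesSpace :=
  a • coordFunctional 0 + b • coordFunctional 1 + c • coordFunctional 2 + d • coordFunctional 3

theorem coords_quad (a b c d : ℝ) :
    coords (quad a b c d) 0 = a ∧ coords (quad a b c d) 1 = b ∧ coords (quad a b c d) 2 = c ∧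
      coords (quad a b c d) 3 = d ∧ ∀ n, coords (quad a b c d) (n + 4) = 0 := by
  simp [quad, coords_add, coords_smul, coords_coordFunctional]

theorem hasSum_jumps_quad (a b c d : ℝ) :
    HasSum (fun n => jumps (coords (quad a b c d)) n ^ 2)
      (a ^ 2 + (if b = a then 0 else b ^ 2) + (if c = b then 0 else c ^ 2) +
        if d = c then 0 else d ^ 2) := by
  obtain ⟨h0, h1, h2, h3, h4⟩ := coords_quad a b c d
  have h := hasSum_sum_of_ne_finset_zero (L := SummationFilter.unconditional ℕ) (f := fun n => jumps (coords (quad a b c d)) n ^ 2)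
    (s := Finset.range 4) fun n hn => by
      obtain ⟨m, rfl⟩ : ∃ m, n = m + 4 := ⟨n - 4, by rw [Finset.mem_range] at hn; omega⟩
      rw [jumps, h4, ite_self, zero_pow two_ne_zero]
  convert h using 1
  simp only [Finset.sum_range_succ, Finset.sum_range_zero, jumps_zero, jumps_succ, h0, h1, h2, h3,
    zero_add, ite_pow, zero_pow two_ne_zero, Nat.reduceAdd]

theorem quad_mem_closedBall {a b c d : ℝ}
    (h : a ^ 2 + (if b = a then 0 else b ^ 2) + (if c = b then 0 else c ^ 2) +
        (if d = c then 0 else d ^ 2) ≤ 1) :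
    quad a b c d ∈ Metric.closedBall (0 : StrongDual ℝ JamesSpace) 1 := by
  rw [mem_closedBall_zero_iff]
  exact (norm_le_sqrt (B := 1) fun N =>
    (sum_le_hasSum _ (fun _ _ => sq_nonneg _) (hasSum_jumps_quad a b c d)).trans h).trans_eq
      Real.sqrt_one

theorem quad_not_mem_extDualBall {s : ℝ} (hs : s ≠ 0) (h : 2 * s ^ 2 ≤ 1) :
    quad s 0 0 (-s) ∉ extDualBall := by
  intro he
  have hne : -s ≠ s := fun h => hs (by linarith)
  -- Filling the two zeros with `s` or with `-s` only lengthens one of the two nonzero runs, so `Q`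
  -- stays `2 * s ^ 2`; the original functional is the midpoint.
  have h1 : quad s s s (-s) ∈ Metric.closedBall (0 : StrongDual ℝ JamesSpace) 1 :=
    quad_mem_closedBall (by simp only [if_true, if_neg hne]; linarith)
  have h2 : quad s (-s) (-s) (-s) ∈ Metric.closedBall (0 : StrongDual ℝ JamesSpace) 1 :=
    quad_mem_closedBall (by simp only [if_true, if_neg hne]; linarith)
  have h3 := (mem_extremePoints_iff_left.1 he).2 _ h1 _ h2
    ⟨1 / 2, 1 / 2, by norm_num, by norm_num, by norm_num, by simp only [quad]; module⟩
  have h4 := congrFun (congrArg coords h3) 1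
  rw [(coords_quad _ _ _ _).2.1, (coords_quad _ _ _ _).2.1] at h4
  exact hs h4

theorem quad_mem_extDualBall {s t : ℝ} (ht : 0 < t) (h : s ^ 2 * (2 * (1 + t ^ 2)) = 1) : quad s (-(s * t)) (s * t) (-s) ∈ extDualBall := by
  obtain ⟨h0, h1, h2, h3, h4⟩ := coords_quad s (-(s * t)) (s * t) (-s)
  set f := quad s (-(s * t)) (s * t) (-s) with hf
  have hs : s ≠ 0 := by rintro rfl; simp at h
  have hst : s * t ≠ 0 := mul_ne_zero hs ht.ne'
  have n1 : -(s * t) ≠ s := fun h => by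
    have : s * (1 + t) = 0 := by linarith
    rcases mul_eq_zero.1 this with h | h
    · exact hs h
    · linarith
  have n2 : s * t ≠ -(s * t) := fun h => hst (by linarith)
  have n3 : -s ≠ s * t := fun h => n1 (by linarith)
  have j0 : jumps (coords f) 0 = s := by rw [jumps_zero, h0]
  have j1 : jumps (coords f) 1 = -(s * t) := by rw [jumps_succ, h0, h1, if_neg n1]
  have j2 : jumps (coords f) 2 = s * t := by rw [jumps_succ, h1, h2, if_neg n2]
  have j3 : jumps (coords f) 3 = -s := by rw [jumps_succ, h2, h3, if_neg n3]
  have j4 : ∀ n, 4 ≤ n → jumps (coords f) n = 0 := fun n hn => by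
    obtain ⟨m, rfl⟩ : ∃ m, n = m + 4 := ⟨n - 4, by omega⟩
    rw [jumps, h4, ite_self]
  refine mem_extDualBall ?_ ?_ ?_
  · have := hasSum_jumps_quad s (-(s * t)) (s * t) (-s)
    rw [if_neg n1, if_neg n2, if_neg n3] at this
    convert this using 1
    linear_combination -h
  -- The jumps are `s, -st, st, -s`; each of the finitely many intervals inside `[0, 3]` is checked
  -- directly, and beyond `3` all jumps vanish.
  · have hsmall : ∀ u v, v < 4 → (∑ k ∈ Finset.Icc u v, jumps (coords f) k) ^ 2 ≤
        ∑ k ∈ Finset.Icc u v, jumps (coords f) k ^ 2 := by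
      intro u v hv
      rcases lt_or_ge v u with huv | huv
      · simp [Finset.Icc_eq_empty_of_lt huv]
      have hu : u < 4 := by omega
      have hs2 := sq_nonneg s
      have hst2 : 0 ≤ s ^ 2 * t := by positivity
      have hst3 : 0 ≤ s ^ 2 * t ^ 2 := by positivity
      interval_cases v <;> interval_cases u <;>
        simp only [Finset.sum_Icc_succ_top, Finset.Icc_self, Finset.sum_singleton, j0, j1, j2, j3,
          Nat.reduceAdd, Nat.reduceLeDiff] <;> nlinarith
    intro u v
    rcases lt_or_ge v 4 with hv | hv
    · exact hsmall u v hv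
    · have hsub : ∀ g : ℕ → ℝ, (∀ n, 4 ≤ n → g n = 0) →
          ∑ k ∈ Finset.Icc u v, g k = ∑ k ∈ Finset.Icc u 3, g k := fun g hg => by
        refine (Finset.sum_subset (Finset.Icc_subset_Icc le_rfl (by omega)) fun k h1 h2 =>
          hg k ?_).symm
        simp only [Finset.mem_Icc] at h1 h2
        omega
      rw [hsub _ j4, hsub (fun k => jumps (coords f) k ^ 2) fun n hn => by simp [j4 n hn]]
      exact hsmall u 3 (by norm_num)
  · intro i j k hij hjk _ hk
    have hk4 : k < 4 := by
      by_contra hc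
      obtain ⟨m, rfl⟩ : ∃ m, k = m + 4 := ⟨k - 4, by omega⟩
      exact hk (h4 m)
    have hj : j = 1 ∨ j = 2 := by omega
    rcases hj with rfl | rfl
    · rw [h1]; exact neg_ne_zero.2 hst
    · rwa [h2]

end James

end

/-! ### The main theorem -/

theorem mainTheorem9 :
    -- the set of extreme points of the dual ball is not norm-closed
    ¬ IsClosed James.extDualBall ∧
    -- an explicit sequence of extreme points with a non-extreme limit
    ((1 / √2 : ℝ) • (James.coordFunctional 0 - James.coordFunctional 3) ∉ James.extDualBall ∧
      (∀ m : ℕ, 1 ≤ m →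
        ((m : ℝ) / √(2 * ((m : ℝ) ^ 2 + 1))) •
          (James.coordFunctional 0 - (1 / (m : ℝ)) • James.coordFunctional 1 +
            (1 / (m : ℝ)) • James.coordFunctional 2 - James.coordFunctional 3) ∈
              James.extDualBall) ∧
      Filter.Tendsto
        (fun m : ℕ =>
          ‖((m : ℝ) / √(2 * ((m : ℝ) ^ 2 + 1))) •
              (James.coordFunctional 0 - (1 / (m : ℝ)) • James.coordFunctional 1 +
                (1 / (m : ℝ)) • James.coordFunctional 2 - James.coordFunctional 3) -
            (1 / √2 : ℝ) • (James.coordFunctional 0 - James.coordFunctional 3)‖)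
        Filter.atTop (nhds 0)) ∧
    -- the elements of the norm-closure of the set of extreme points
    (∀ (F : Set ℕ) (I : ℕ → NatInterval) (α : ℕ → ℝ) (f : StrongDual ℝ JamesSpace),
      IsLowerSet F →
      (∀ i, i + 1 ∈ F → (I i).hi < ((I (i + 1)).lo : ℕ∞)) →
      (∀ i ∈ F, α i ≠ 0) →
      HasSum (fun i : F => α i • James.intervalFunctional (I i)) f →
      f ∈ James.setD₁ →
      ‖f‖ = 1 →
      (f ∈ closure James.extDualBall ↔ 1 ∉ James.gapFunction F I '' F)) := by
  have hnot : (1 / √2 : ℝ) • (James.coordFunctional 0 - James.coordFunctional 3) ∉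
      James.extDualBall := by
    have h := James.quad_not_mem_extDualBall (s := 1 / √2) (by positivity) (by
      rw [div_pow, Real.sq_sqrt zero_le_two]; norm_num)
    intro hc
    refine h ?_
    convert hc using 1
    simp only [James.quad]
    module
  have hmem : ∀ m : ℕ, 1 ≤ m →
      ((m : ℝ) / √(2 * ((m : ℝ) ^ 2 + 1))) •
        (James.coordFunctional 0 - (1 / (m : ℝ)) • James.coordFunctional 1 +
          (1 / (m : ℝ)) • James.coordFunctional 2 - James.coordFunctional 3) ∈
            James.extDualBall := by
    intro m hm
    have hm0 : (0 : ℝ) < m := by exact_mod_cast hm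
    have h := James.quad_mem_extDualBall (s := (m : ℝ) / √(2 * ((m : ℝ) ^ 2 + 1)))
      (t := 1 / (m : ℝ)) (by positivity) (by
        rw [div_pow, Real.sq_sqrt (by positivity)]
        field_simp)
    convert h using 1
    simp only [James.quad]
    module
  have hlim : Filter.Tendsto
      (fun m : ℕ =>
        ‖((m : ℝ) / √(2 * ((m : ℝ) ^ 2 + 1))) •
            (James.coordFunctional 0 - (1 / (m : ℝ)) • James.coordFunctional 1 +
              (1 / (m : ℝ)) • James.coordFunctional 2 - James.coordFunctional 3) -
          (1 / √2 : ℝ) • (James.coordFunctional 0 - James.coordFunctional 3)‖)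
      Filter.atTop (nhds 0) := by
    rw [← tendsto_iff_norm_sub_tendsto_zero]
    have h1 : Filter.Tendsto (fun m : ℕ => 1 / (m : ℝ)) Filter.atTop (nhds 0) :=
      tendsto_one_div_atTop_nhds_zero_nat
    have h2 : Filter.Tendsto (fun m : ℕ => (m : ℝ) / √(2 * ((m : ℝ) ^ 2 + 1))) Filter.atTop
        (nhds (1 / √2)) := by
      -- Dividing numerator and denominator by `m` gives this form, continuous in `1 / m`; the two
      -- agree only for `m > 0`.
      have h3 : Filter.Tendsto (fun m : ℕ => 1 / √(2 * (1 + (1 / (m : ℝ)) ^ 2))) Filter.atTop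
          (nhds (1 / √2)) := by
        have h4 := (((h1.pow 2).const_add 1).const_mul 2).sqrt
        simp only [ne_eq, OfNat.ofNat_ne_zero, not_false_eq_true, zero_pow, add_zero,
          mul_one] at h4
        exact tendsto_const_nhds.div h4 (by positivity)
      refine h3.congr' ?_
      filter_upwards [Filter.eventually_gt_atTop 0] with m hm
      have hm0 : (0 : ℝ) < m := by exact_mod_cast hm
      have h5 : 2 * ((m : ℝ) ^ 2 + 1) = (m : ℝ) ^ 2 * (2 * (1 + (1 / (m : ℝ)) ^ 2)) := by
        field_simp
      rw [h5, Real.sqrt_mul (sq_nonneg _), Real.sqrt_sq hm0.le, ← div_div, div_self hm0.ne']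
    have h6 := h2.smul ((((tendsto_const_nhds (x := James.coordFunctional 0)).sub
      (h1.smul_const (James.coordFunctional 1))).add
        (h1.smul_const (James.coordFunctional 2))).sub
          (tendsto_const_nhds (x := James.coordFunctional 3)))
    rwa [zero_smul, zero_smul, sub_zero, add_zero] at h6
  refine ⟨fun hcl => hnot ?_, ⟨hnot, hmem, hlim⟩, fun F I α f hF hI hα hf hf₁ hf1 => ?_⟩
  · refine hcl.mem_of_tendsto (tendsto_iff_norm_sub_tendsto_zero.2 hlim) ?_
    filter_upwards [Filter.eventually_ge_atTop 1] with m hm using hmem m hm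
  · rw [James.mem_closure_extDualBall_iff hf₁ hf1, James.noUnitGap_iff hF hI hα hf]
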